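/- **Setting.** Let $f:\mathbb{R}^d\times\mathbb{R}^{d'}\to\mathbb{R}$ be differentiable with $L_f$-Lipschitz gradient, $\mathcal Y\subseteq\mathbb{R}^{d'}$, and suppose that $F(x)=\max_{y\in\mathcal Y}f(x,y)$ exists for every $x$ and is differentiable with $L_F$-Lipschitz gradient. Let $0<\lambda\le L_f$ and $\kappa=L_f/\lambda$. Assume that either (i) $\mathcal Y$ is convex (bounded or not) and $f(x,\cdot)$ is $\lambda$-strongly concave over $\mathcal Y$ for every $x$, or (ii) $\mathcal Y=\mathbb{R}^{d'}$, every $f(x,\cdot)$ is concave, and the dual-side PL condition $\|\nabla_y f(x,y)\|^2\ge 2\lambda\,(F(x)-f(x,y))$ holds for all $x,y$. A stochastic oracle returns at any $(x,y)$ a random pair $(\mathcal O_x(x,y),\mathcal O_y(x,y))$ with means $\nabla_xf(x,y),\nabla_yf(x,y)$ and with variances $\mathrm E\|\mathcal O_x-\nabla_xf\|^2\le\sigma^2$, $\mathrm E\|\mathcal O_y-\nabla_yf\|^2\le\sigma^2$; calls at different iterations use independent samples. The starting point satisfies $F(x_0)-\inf F\le\Delta_F$. Here $L_F,\sigma>0$.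 **Method (PDSM/PDAda).** From $x_0$, and square-integrable $y_0,v_0$ ($y_0$ independent of the oracle samples; $v_0$ may depend on the first sample, but not on later ones), for $t=0,1,\dots$, with one oracle call at $(x_t,y_t)$ per iteration: $$v_{t+1}=(1-\gamma)v_t+\gamma\,\mathcal O_x(x_t,y_t),\qquad x_{t+1}=x_t-\eta_x\, s_t\circ v_{t+1},\qquad y_{t+1}=\Pi_{\mathcal Y}[y_t+\eta_y\,\mathcal O_y(x_t,y_t)],$$ where $s_t=1/(\sqrt{u_{t+1}}+G_0)$ elementwise, $G_0\ge0$, $u_{t+1}$ is any measurable function of $v_0$ and of $\mathcal O_x(x_0,y_0),\dots,\mathcal O_x(x_t,y_t)$, and almost surely $c_l\le s_{t,i}\le c_u$ for all $t,i$, with constants $0<c_l\le c_u$. Put $\Delta_{x,t}=\|v_{t+1}-\nabla_xf(x_t,y_t)\|^2$, $\Delta^*_{x,t}=\|v_{t+1}-\nabla F(x_t)\|^2$, where $\nabla F(x_t)=\nabla_xf(x_t,y^*(x_t))$, and $\delta_{y,t}=\|y_t-y^*(x_t)\|^2$, where $y^*(x_t)$ is the maximizer of $f(x_t,\cdot)$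 over $\mathcal Y$ (in case (ii), the one nearest to $y_t$). **Theorem.** There are universal constants $a,C>0$ such that the following hold. (1) *Convergence.* Let $\varepsilon,\gamma,\eta_x,\eta_y>0$ with $$\gamma\le a\frac{c_l\varepsilon^2}{40c_u\sigma^2},\quad \eta_x\le a\sqrt{\frac{c_l}{c_u^3}}\min\Big\{\frac{\eta_y\lambda}{48L_f\kappa},\frac{\gamma}{8L_F}\Big\},\quad \eta_y\le a\frac{c_l\lambda\varepsilon^2}{400c_uL_f^2\sigma^2},$$ and also $\gamma\le\frac14$, $\eta_x\le\frac{c_l}{2c_u^2L_F}$, $\eta_y\le\frac{\lambda}{2L_f^2}$, and let $$T\ge C\max\Big\{\frac{10\Delta_F}{\eta_xc_l\varepsilon^2},\ \frac{10c_u\mathrm E[\Delta^*_{x,0}]}{\gamma c_l\varepsilon^2},\ \frac{200c_uL_f^2\,\mathrm E[\delta_{y,0}]}{c_l\eta_y\lambda\varepsilon^2}\Big\}.$$ Then $$\mathrm E\Big[\frac1{T+1}\sum_{t=0}^T\|\nabla F(x_t)\|^2\Big]\le\varepsilon^2,\qquad \mathrm E\Big[\frac1{T+1}\sum_{t=0}^T(\Delta_{x,t}+L_f^2\delta_{y,t})\Big]\le5\varepsilon^2,$$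 and the second bound also holds with $\Delta^*_{x,t}$ in place of $\Delta_{x,t}$. (2) *Sample complexity $O(\kappa^3/\varepsilon^4)$.* For all $c_l,c_u,L_f,\sigma,\Delta_F,D,R,B$ there is a constant $K$ such that for all $\lambda\in(0,L_f]$, all $L_F\in(0,B\kappa]$ and all $\varepsilon\in(0,1]$ there are $\gamma,\eta_x,\eta_y,T$ that satisfy the conditions of (1) (with $D$, $R$ in place of $\mathrm E[\Delta^*_{x,0}]$, $\mathrm E[\delta_{y,0}]$), such that the number of oracle calls satisfies $T+1\le K\kappa^3/\varepsilon^4$, and such that the conclusions of (1) hold for every problem with these constants, in any dimensions, and every run with $\mathrm E[\Delta^*_{x,0}]\le D$ and $\mathrm E[\delta_{y,0}]\le R$. -/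

import Mathlib

open MeasureTheory ProbabilityTheory

/-- `ℝ^n` with the Euclidean norm. -/
abbrev Euc (n : ℕ) : Type := EuclideanSpace ℝ (Fin n)

/-- The partial gradient `∇ₓ f(x, y)`. -/
noncomputable def gradX {d d' : ℕ} (f : Euc d → Euc d' → ℝ) (x : Euc d) (y : Euc d') : Euc d :=
  gradient (fun x' => f x' y) x

/-- The partial gradient `∇_y f(x, y)`. -/
noncomputable def gradY {d d' : ℕ} (f : Euc d → Euc d' → ℝ) (x : Euc d) (y : Euc d') : Euc d' :=
  gradient (fun y' => f x y') y

/-- The set of maximizers of `f(x, ·)` over `Y`. -/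
def argmaxSet {d d' : ℕ} (Y : Set (Euc d')) (f : Euc d → Euc d' → ℝ) (x : Euc d) :
    Set (Euc d') :=
  {y | y ∈ Y ∧ ∀ y' ∈ Y, f x y' ≤ f x y}

/-- `p` is a Euclidean projection of `z` onto `Y`. -/
def IsProjOn {n : ℕ} (Y : Set (Euc n)) (z p : Euc n) : Prop :=
  p ∈ Y ∧ ∀ q ∈ Y, ‖z - p‖ ≤ ‖z - q‖

/-- The differentiable function `g` is `lam`-strongly concave over `Y`. -/
def StronglyConcaveOver {n : ℕ} (Y : Set (Euc n)) (lam : ℝ) (g : Euc n → ℝ) : Prop :=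
  ∀ y ∈ Y, ∀ y' ∈ Y,
    g y ≤ g y' + inner ℝ (gradient g y') (y - y') - lam / 2 * ‖y - y'‖ ^ 2

/-- The assumptions on the min-max problem `min_x F(x)`, `F(x) = max_{y ∈ Y} f(x, y)`, on its
stochastic first-order oracle `(Ox, Oy)` (one call of the oracle at `(x, y)` draws a sample
`s ∼ ν` and returns the pair `(Ox x y s, Oy x y s)`), and on the starting point `x0`. -/
structure MinMaxAssumption {d d' : ℕ} {Ξ : Type*} [MeasurableSpace Ξ] (ν : Measure Ξ)
    (Y : Set (Euc d')) (f : Euc d → Euc d' → ℝ) (F : Euc d → ℝ)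
    (Ox : Euc d → Euc d' → Ξ → Euc d) (Oy : Euc d → Euc d' → Ξ → Euc d')
    (Lf LF lam σ ΔF : ℝ) (x0 : Euc d) : Prop where
  /-- `F(x) = max_{y ∈ Y} f(x, y)`, the maximum being attained. -/
  isMax : ∀ x, IsGreatest (f x '' Y) (F x)
  /-- `F` is `LF`-smooth. -/
  diff_F : Differentiable ℝ F
  lip_F : ∀ x x', ‖gradient F x - gradient F x'‖ ≤ LF * ‖x - x'‖
  /-- `∇f = (∇ₓ f, ∇_y f)` is `Lf`-Lipschitz. -/
  diff_f : Differentiable ℝ (fun p : Euc d × Euc d' => f p.1 p.2)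
  lip_f : ∀ x x' y y',
    ‖gradX f x y - gradX f x' y'‖ ^ 2 + ‖gradY f x y - gradY f x' y'‖ ^ 2
      ≤ Lf ^ 2 * (‖x - x'‖ ^ 2 + ‖y - y'‖ ^ 2)
  /-- The oracle is measurable, unbiased, with variance at most `σ²` in each component. -/
  meas_Ox : Measurable (fun p : (Euc d × Euc d') × Ξ => Ox p.1.1 p.1.2 p.2)
  meas_Oy : Measurable (fun p : (Euc d × Euc d') × Ξ => Oy p.1.1 p.1.2 p.2)
  memLp_Ox : ∀ x y, MemLp (Ox x y) 2 ν
  memLp_Oy : ∀ x y, MemLp (Oy x y) 2 ν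
  mean_Ox : ∀ x y, ∫ s, Ox x y s ∂ν = gradX f x y
  mean_Oy : ∀ x y, ∫ s, Oy x y s ∂ν = gradY f x y
  var_Ox : ∀ x y, ∫ s, ‖Ox x y s - gradX f x y‖ ^ 2 ∂ν ≤ σ ^ 2
  var_Oy : ∀ x y, ∫ s, ‖Oy x y s - gradY f x y‖ ^ 2 ∂ν ≤ σ ^ 2
  /-- Either `Y` is convex and every `f(x, ·)` is `lam`-strongly concave over `Y`; or `Y` is the
  whole space, every `f(x, ·)` is concave, and the dual-side `lam`-PL condition holds. -/
  dual :
    (Convex ℝ Y ∧ ∀ x, StronglyConcaveOver Y lam (f x)) ∨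
    (Y = Set.univ ∧ (∀ x, ConcaveOn ℝ Set.univ (f x)) ∧
      ∀ x y, 2 * lam * (F x - f x y) ≤ ‖gradY f x y‖ ^ 2)
  /-- `F(x0) - min F ≤ ΔF`. -/
  init : ∀ x, F x0 - F x ≤ ΔF

/-- The randomness of the method: `ξ t`, the sample used in iteration `t`, has law `ν` and is
independent of the past `ℱ t`. The starting dual point `y0` is known before the first sample;
the starting estimator `v0` may also depend on the first sample (as in `v0 = Ox x0 y0 (ξ 0)`). -/
structure IsSampling {d d' : ℕ} {Ω Ξ : Type*} [mΩ : MeasurableSpace Ω] [mΞ : MeasurableSpace Ξ]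
    (μ : Measure Ω) (ν : Measure Ξ) (ℱ : Filtration ℕ mΩ) (ξ : ℕ → Ω → Ξ)
    (y0 : Ω → Euc d') (v0 : Ω → Euc d) : Prop where
  meas_ξ : ∀ t, Measurable[ℱ (t + 1)] (ξ t)
  law_ξ : ∀ t, μ.map (ξ t) = ν
  indep_ξ : ∀ t, Indep (ℱ t) (MeasurableSpace.comap (ξ t) mΞ) μ
  meas_y0 : Measurable[ℱ 0] y0
  meas_v0 : Measurable[ℱ 1] v0
  memLp_y0 : MemLp y0 2 μ
  memLp_v0 : MemLp v0 2 μ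

/-- The single-loop primal-dual stochastic momentum / adaptive method (`1 - β = γ`). Iteration `t`
makes exactly one call of the oracle, at `(x t, y t)` with the sample `ξ t`. The second-order
quantity `u (t+1)` is any function `h t` of the stochastic `x`-gradients seen so far (and of
`v0`); `u = 1`, `G0 = 0` is the momentum method. -/
structure IsPDAdaRun {d d' : ℕ} {Ω Ξ : Type*} (Y : Set (Euc d'))
    (Ox : Euc d → Euc d' → Ξ → Euc d) (Oy : Euc d → Euc d' → Ξ → Euc d')
    (h : (t : ℕ) → Euc d → (Fin (t + 1) → Euc d) → Euc d) (G0 γ ηx ηy : ℝ)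
    (ξ : ℕ → Ω → Ξ) (x0 : Euc d) (y0 : Ω → Euc d') (v0 : Ω → Euc d)
    (x : ℕ → Ω → Euc d) (y : ℕ → Ω → Euc d') (u v : ℕ → Ω → Euc d) : Prop where
  x_zero : ∀ ω, x 0 ω = x0
  y_zero : ∀ ω, y 0 ω = y0 ω
  v_zero : ∀ ω, v 0 ω = v0 ω
  v_succ : ∀ t ω, v (t + 1) ω = (1 - γ) • v t ω + γ • Ox (x t ω) (y t ω) (ξ t ω)
  u_succ : ∀ t ω, u (t + 1) ω =
    h t (v0 ω) (fun j : Fin (t + 1) => Ox (x j ω) (y j ω) (ξ j ω))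
  x_succ : ∀ t ω i, x (t + 1) ω i
    = x t ω i - ηx * (v (t + 1) ω i / (√(u (t + 1) ω i) + G0))
  y_succ : ∀ t ω, IsProjOn Y (y t ω + ηy • Oy (x t ω) (y t ω) (ξ t ω)) (y (t + 1) ω)

/-- Almost surely all step size scaling factors `1 / (√u + G0)` lie in `[cl, cu]`. -/
def ScalingBounded {d : ℕ} {Ω : Type*} [MeasurableSpace Ω] (μ : Measure Ω) (G0 cl cu : ℝ)
    (u : ℕ → Ω → Euc d) : Prop :=
  ∀ᵐ ω ∂μ, ∀ t i, cl ≤ 1 / (√(u (t + 1) ω i) + G0) ∧ 1 / (√(u (t + 1) ω i) + G0) ≤ cu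

/-- `Δ_{x,t} = ‖v_{t+1} - ∇ₓ f(x_t, y_t)‖²`. -/
noncomputable def primalErr {d d' : ℕ} {Ω : Type*} (f : Euc d → Euc d' → ℝ)
    (x : ℕ → Ω → Euc d) (y : ℕ → Ω → Euc d') (v : ℕ → Ω → Euc d) (t : ℕ) (ω : Ω) : ℝ :=
  ‖v (t + 1) ω - gradX f (x t ω) (y t ω)‖ ^ 2

/-- `‖v_{t+1} - ∇F(x_t)‖²`, which is `‖v_{t+1} - ∇ₓ f(x_t, y*(x_t))‖²`. -/
noncomputable def primalErrStar {d : ℕ} {Ω : Type*} (F : Euc d → ℝ)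
    (x : ℕ → Ω → Euc d) (v : ℕ → Ω → Euc d) (t : ℕ) (ω : Ω) : ℝ :=
  ‖v (t + 1) ω - gradient F (x t ω)‖ ^ 2

/-- `δ_{y,t} = ‖y_t - y*(x_t)‖²`, with `y*(x_t)` the maximizer of `f(x_t, ·)` over `Y` (the one
nearest to `y_t` where it is not unique). -/
noncomputable def dualErr {d d' : ℕ} {Ω : Type*} (Y : Set (Euc d')) (f : Euc d → Euc d' → ℝ)
    (x : ℕ → Ω → Euc d) (y : ℕ → Ω → Euc d') (t : ℕ) (ω : Ω) : ℝ :=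
  Metric.infDist (y t ω) (argmaxSet Y f (x t ω)) ^ 2

/-- The time average of a process over `t = 0, …, T`. -/
noncomputable def timeAvg {Ω : Type*} (T : ℕ) (Z : ℕ → Ω → ℝ) (ω : Ω) : ℝ :=
  1 / ((T : ℝ) + 1) * ∑ t ∈ Finset.range (T + 1), Z t ω

/-- The expectation of `Z` exists as a finite number and is at most `b`. -/
def ExpectLE {Ω : Type*} [MeasurableSpace Ω] (μ : Measure Ω) (Z : Ω → ℝ) (b : ℝ) : Prop :=
  Integrable Z μ ∧ ∫ ω, Z ω ∂μ ≤ b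

/-- The convergence guarantee at accuracy `ε` after the iterations `0, …, T`. -/
def Guarantee {d d' : ℕ} {Ω : Type*} [MeasurableSpace Ω] (μ : Measure Ω) (Y : Set (Euc d'))
    (f : Euc d → Euc d' → ℝ) (F : Euc d → ℝ) (Lf ε : ℝ) (T : ℕ)
    (x : ℕ → Ω → Euc d) (y : ℕ → Ω → Euc d') (v : ℕ → Ω → Euc d) : Prop :=
  ExpectLE μ (timeAvg T fun t ω => ‖gradient F (x t ω)‖ ^ 2) (ε ^ 2) ∧
  ExpectLE μ (timeAvg T fun t ω => primalErr f x y v t ω + Lf ^ 2 * dualErr Y f x y t ω)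
    (5 * ε ^ 2) ∧
  ExpectLE μ (timeAvg T fun t ω => primalErrStar F x v t ω + Lf ^ 2 * dualErr Y f x y t ω)
    (5 * ε ^ 2)

/-- The conditions on the parameters `γ`, `ηx`, `ηy`; the factor `a` is the constant hidden in
`O(·)`, and `κ = Lf / lam`. The conditions `γ ≤ 1/4`, `ηy ≤ lam / (2 Lf²)` and
`ηx ≤ cl / (2 cu² LF)` follow from the others when `a ≤ 1` and `ε ≤ σ`. -/
structure StepSizes (a cl cu Lf LF lam σ ε γ ηx ηy : ℝ) : Prop where
  γ_pos : 0 < γ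
  ηx_pos : 0 < ηx
  ηy_pos : 0 < ηy
  γ_le : γ ≤ a * (cl * ε ^ 2 / (40 * cu * σ ^ 2))
  ηx_le : ηx ≤ a * (√(cl / cu ^ 3) *
    min (ηy * lam / (48 * Lf * (Lf / lam))) (γ / (8 * LF)))
  ηy_le : ηy ≤ a * (cl * lam * ε ^ 2 / (400 * cu * Lf ^ 2 * σ ^ 2))
  γ_cap : γ ≤ 1 / 4
  ηx_cap : ηx ≤ cl / (2 * cu ^ 2 * LF)
  ηy_cap : ηy ≤ lam / (2 * Lf ^ 2)

/-- The lower bound on `T`; `D` and `R` stand for the expected initial errors of the primal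
estimator and of the dual variable, and `C` is the constant hidden in `O(·)`. -/
def LongEnough (C cl cu Lf lam ε γ ηx ηy ΔF D R : ℝ) (T : ℕ) : Prop :=
  C * max (10 * ΔF / (ηx * cl * ε ^ 2))
    (max (10 * cu * D / (γ * cl * ε ^ 2))
      (200 * cu * Lf ^ 2 * R / (cl * ηy * lam * ε ^ 2))) ≤ (T : ℝ)

/-!
Three inequalities carry the proof; they relate the expectations of `‖∇F(x_t)‖²`, of `‖v_{t+1}‖²`,
of the primal error `‖v_{t+1} - ∇F(x_t)‖²` and of the dual error `dist(y_t, argmax f(x_t, ·))²`.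

* Descent (`IsAdmissibleRun.sum_integral_descent`): since the step is coordinatewise between
  `ηx cl v` and `ηx cu v`, smoothness of `F` bounds the sums of `‖∇F(x_t)‖²` and of `‖v_{t+1}‖²`
  by the initial gap and the summed primal error.
* Momentum (`IsAdmissibleRun.integral_primalErrStar_succ_le`): the primal error contracts by the
  factor `1 - γ / 2`, up to the drift of `∇F(x_t)`, which is controlled by `ηx² ‖v_{t+1}‖²`, the
  dual error (by the envelope theorem `∇F(x) = ∇ₓ f(x, y*(x))`) and the noise `γ² σ²`.
* Dual ascent (`IsAdmissibleRun.integral_dualErr_succ_le`): the dual error contracts by the factor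
  `1 - ηy lam / 4`, up to the drift of the maximizers and the noise.

Both cases of the dual assumption provide the same geometry: a nearest maximizer exists
(`MinMaxAssumption.exists_infDist_argmax_eq`), the solution map
`x ↦ argmax f(x, ·)` is `Lf / lam`-Lipschitz (`MinMaxAssumption.infDist_argmax_le`), and a gradient
step contracts the distance to it (`MinMaxAssumption.norm_step_sub_sq_le`). In the strongly concave
case these are variational inequalities. In the Polyak-Łojasiewicz case they follow from quadratic
growth (`sq_infDist_le_of_pl`).

Once the inequalities are summed over `t`, `sums_le_of_recursions` absorbs the `‖v_{t+1}‖²`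
terms into the descent inequality; the constants `a = C = 1` are enough. The conditional
expectations are handled by `integral_le_of_indep`, which integrates out the fresh sample for a fixed past.
-/

/-! ### Smooth functions, the Polyak-Łojasiewicz inequality and projections -/

theorem hasDerivAt_comp_line {n : ℕ} {g : Euc n → ℝ} (hg : Differentiable ℝ g)
    (x w : Euc n) (t : ℝ) :
    HasDerivAt (fun s : ℝ => g (x + s • w)) (inner ℝ (gradient g (x + t • w)) w) t := by
  have h1 : HasDerivAt (fun s : ℝ => x + s • w) w t := by
    simpa using ((hasDerivAt_id t).smul_const w).const_add x
  have h2 := (hg (x + t • w)).hasFDerivAt.comp_hasDerivAt t h1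
  rw [inner_gradient_left]
  exact h2

theorem le_add_inner_gradient_add_sq {n : ℕ} {F : Euc n → ℝ} {L : ℝ}
    (hF : Differentiable ℝ F)
    (hL : ∀ x x', ‖gradient F x - gradient F x'‖ ≤ L * ‖x - x'‖) (x z : Euc n) :
    F z ≤ F x + inner ℝ (gradient F x) (z - x) + L / 2 * ‖z - x‖ ^ 2 := by
  set w := z - x with hw
  let k : ℝ → ℝ := fun t => F (x + t • w) - t * inner ℝ (gradient F x) w - L / 2 * ‖w‖ ^ 2 * t ^ 2
  have hk : ∀ t, HasDerivAt k (inner ℝ (gradient F (x + t • w)) w - inner ℝ (gradient F x) w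
      - L * ‖w‖ ^ 2 * t) t := by
    intro t
    have h1 := ((hasDerivAt_comp_line hF x w t).sub
      ((hasDerivAt_id t).mul_const (inner ℝ (gradient F x) w))).sub
      (((hasDerivAt_id t).pow 2).const_mul (L / 2 * ‖w‖ ^ 2))
    refine h1.congr_deriv ?_
    simp
    ring
  have hanti : AntitoneOn k (Set.Icc 0 1) := by
    refine antitoneOn_of_deriv_nonpos (convex_Icc 0 1)
      (fun t _ => (hk t).continuousAt.continuousWithinAt)
      (fun t _ => (hk t).differentiableAt.differentiableWithinAt) ?_
    intro t ht
    rw [interior_Icc] at ht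
    rw [(hk t).deriv, ← inner_sub_left]
    have h1 := real_inner_le_norm (gradient F (x + t • w) - gradient F x) w
    have h2 := hL (x + t • w) x
    rw [add_sub_cancel_left, norm_smul, Real.norm_of_nonneg ht.1.le] at h2
    have h3 := mul_le_mul_of_nonneg_right h2 (norm_nonneg w)
    nlinarith
  have h := hanti (Set.left_mem_Icc.2 zero_le_one) (Set.right_mem_Icc.2 zero_le_one) zero_le_one
  simp only [k, one_smul, zero_smul, add_zero, hw, add_sub_cancel] at h
  simp only [hw]
  linarith

theorem ConcaveOn.le_add_inner_gradient {n : ℕ} {g : Euc n → ℝ}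
    (hc : ConcaveOn ℝ Set.univ g) (hg : Differentiable ℝ g) (y z : Euc n) :
    g z ≤ g y + inner ℝ (gradient g y) (z - y) := by
  have hline : ConcaveOn ℝ Set.univ (fun t : ℝ => g (y + t • (z - y))) := by
    have h := hc.comp_affineMap (AffineMap.lineMap y z : ℝ →ᵃ[ℝ] Euc n)
    rw [Set.preimage_univ] at h
    refine h.congr fun t _ => ?_
    simp [AffineMap.lineMap_apply, add_comm]
  have hd := hasDerivAt_comp_line hg y (z - y) 0
  have h := hline.slope_le_of_hasDerivAt (Set.mem_univ 0) (Set.mem_univ 1) zero_lt_one hd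
  simp only [slope_def_field, one_smul, zero_smul, add_zero, sub_zero, div_one,
    add_sub_cancel] at h
  linarith

/-- The Polyak-Łojasiewicz inequality implies quadratic growth. For `c < √(lam / 2)`, a minimizer
of `√(M - g) + c ‖· - y‖` must be a maximizer of `g`, since the slope of `√(M - g)` elsewhere is at
least `√(lam / 2)`; comparing its value with that at `y` bounds the distance. -/
theorem sq_infDist_le_of_pl {n : ℕ} {g : Euc n → ℝ} {lam M : ℝ}
    (hg : Differentiable ℝ g) (hM : ∀ y, g y ≤ M)
    (hPL : ∀ y, 2 * lam * (M - g y) ≤ ‖gradient g y‖ ^ 2) (y : Euc n) :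
    lam / 2 * Metric.infDist y {z | g z = M} ^ 2 ≤ M - g y := by
  set D := Metric.infDist y {z | g z = M} with hD
  have hMy : 0 ≤ M - g y := sub_nonneg.2 (hM y)
  have key : ∀ c : ℝ, 0 < c → c ^ 2 < lam / 2 → c * D ≤ √(M - g y) := by
    intro c hc hc2
    have hcont : Continuous fun z => √(M - g z) + c * ‖z - y‖ := by
      have := hg.continuous
      fun_prop
    have hlim : Filter.Tendsto (fun z => √(M - g z) + c * ‖z - y‖)
        (Filter.cocompact (Euc n)) Filter.atTop := by
      refine Filter.tendsto_atTop_mono (fun z => ?_)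
        ((Filter.tendsto_atTop_add_const_right _ (-‖y‖)
          (tendsto_norm_cocompact_atTop (E := Euc n))).const_mul_atTop hc)
      have h1 := norm_sub_norm_le z y
      have h2 := Real.sqrt_nonneg (M - g z)
      nlinarith
    obtain ⟨zs, hzs⟩ := hcont.exists_forall_le hlim
    have hmax : g zs = M := by
      by_contra hne
      have hpos : 0 < M - g zs := sub_pos.2 (lt_of_le_of_ne (hM zs) hne)
      set φ := √(M - g zs) with hφ
      have hφ0 : 0 < φ := Real.sqrt_pos.2 hpos
      have hφ2 : φ ^ 2 = M - g zs := Real.sq_sqrt hpos.le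
      set w := gradient g zs with hw
      have hder : HasDerivAt (fun t : ℝ => √(M - g (zs + t • w)) + t * (c * ‖w‖))
          (-‖w‖ ^ 2 / (2 * φ) + c * ‖w‖) 0 := by
        have h1 : HasDerivAt (fun t : ℝ => M - g (zs + t • w)) (-‖w‖ ^ 2) 0 := by
          have h0 := (hasDerivAt_comp_line hg zs w 0).const_sub M
          simpa [← hw, real_inner_self_eq_norm_sq] using h0
        have h2 := h1.sqrt (by simpa using hpos.ne')
        have h3 := h2.add ((hasDerivAt_id (0 : ℝ)).mul_const (c * ‖w‖))
        refine h3.congr_deriv ?_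
        simp [← hφ]
      have hslope := hder.tendsto_slope_zero_right
      have hge : 0 ≤ -‖w‖ ^ 2 / (2 * φ) + c * ‖w‖ := by
        refine ge_of_tendsto hslope ?_
        filter_upwards [self_mem_nhdsWithin] with t ht
        have ht : 0 < t := ht
        have h1 := hzs (zs + t • w)
        have h2 : ‖zs + t • w - y‖ ≤ ‖zs - y‖ + t * ‖w‖ := by
          have := norm_add_le (zs - y) (t • w)
          rw [norm_smul, Real.norm_of_nonneg ht.le] at this
          rwa [show zs + t • w - y = zs - y + t • w by abel]
        have h3 := mul_le_mul_of_nonneg_left h2 hc.le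
        simp only [zero_add, zero_smul, add_zero, zero_mul, smul_eq_mul]
        refine mul_nonneg (inv_nonneg.2 ht.le) ?_
        simp only [← hφ] at h1 ⊢
        nlinarith
      have h1 : ‖w‖ ^ 2 ≤ 2 * φ * (c * ‖w‖) := by
        have h2 : ‖w‖ ^ 2 / (2 * φ) ≤ c * ‖w‖ := by
          rw [neg_div] at hge
          linarith
        rw [div_le_iff₀ (by positivity)] at h2
        linarith
      have h2 := hPL zs
      rw [← hφ2, ← hw] at h2
      have h3 : ‖w‖ ≤ 2 * φ * c := by
        rcases (norm_nonneg w).eq_or_lt with h0 | h0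
        · rw [← h0]
          positivity
        · nlinarith
      have h4 : ‖w‖ ^ 2 ≤ (2 * φ * c) ^ 2 := by gcongr
      have h5 := mul_pos hφ0 hφ0
      nlinarith
    have h1 := hzs y
    have h2 : D ≤ ‖zs - y‖ := by
      rw [← dist_eq_norm, dist_comm]
      exact Metric.infDist_le_dist_of_mem hmax
    have h3 := mul_le_mul_of_nonneg_left h2 hc.le
    simp [hmax] at h1
    linarith
  have hD0 : 0 ≤ D := Metric.infDist_nonneg
  rcases hD0.eq_or_lt with h0 | h0
  · rw [← h0]
    simpa using hM y
  rw [← le_div_iff₀ (by positivity)]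
  refine le_of_forall_lt_imp_le_of_dense fun s hs => ?_
  rcases le_or_gt s 0 with hs0 | hs0
  · exact hs0.trans (by positivity)
  · rw [le_div_iff₀ (by positivity)]
    have h1 := key (√s) (Real.sqrt_pos.2 hs0) (by rwa [Real.sq_sqrt hs0.le])
    have h2 : (√s * D) ^ 2 ≤ √(M - g y) ^ 2 := by gcongr
    rwa [mul_pow, Real.sq_sqrt hs0.le, Real.sq_sqrt hMy] at h2

theorem IsProjOn.inner_le_zero {n : ℕ} {Y : Set (Euc n)} (hY : Convex ℝ Y) {z p : Euc n}
    (h : IsProjOn Y z p) : ∀ q ∈ Y, inner ℝ (z - p) (q - p) ≤ 0 := by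
  refine (norm_eq_iInf_iff_real_inner_le_zero hY h.1).1 (le_antisymm ?_ ?_)
  · have : Nonempty Y := ⟨⟨p, h.1⟩⟩
    exact le_ciInf fun q => h.2 q q.2
  · exact ciInf_le (f := fun w : Y => ‖z - w‖)
      ⟨0, Set.forall_mem_range.2 fun _ => norm_nonneg _⟩ ⟨p, h.1⟩

theorem isProjOn_of_inner_le_zero {n : ℕ} {Y : Set (Euc n)} {z p : Euc n} (hp : p ∈ Y)
    (h : ∀ q ∈ Y, inner ℝ (z - p) (q - p) ≤ 0) : IsProjOn Y z p := by
  refine ⟨hp, fun q hq => ?_⟩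
  refine le_of_sq_le_sq ?_ (norm_nonneg _)
  have h1 := norm_sub_sq_real (z - p) (q - p)
  rw [sub_sub_sub_cancel_right] at h1
  nlinarith [h q hq, sq_nonneg ‖q - p‖]

theorem IsProjOn.norm_sub_le {n : ℕ} {Y : Set (Euc n)} (hY : Convex ℝ Y) {z w p q : Euc n}
    (hp : IsProjOn Y z p) (hq : IsProjOn Y w q) : ‖p - q‖ ≤ ‖z - w‖ := by
  have h1 := hp.inner_le_zero hY q hq.1
  have h2 := hq.inner_le_zero hY p hp.1
  have h3 : ‖p - q‖ ^ 2 ≤ inner ℝ (z - w) (p - q) := by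
    have e : inner ℝ (z - w) (p - q) - ‖p - q‖ ^ 2
        = -(inner ℝ (z - p) (q - p) + inner ℝ (w - q) (p - q)) := by
      rw [← real_inner_self_eq_norm_sq, ← inner_sub_left,
        ← neg_sub p q, inner_neg_right, neg_add, neg_neg, ← sub_eq_add_neg, ← inner_sub_left]
      congr 1
      abel
    linarith
  have h4 := real_inner_le_norm (z - w) (p - q)
  rcases (norm_nonneg (p - q)).eq_or_lt with h0 | h0
  · rw [← h0]
    exact norm_nonneg _
  · nlinarith

theorem IsProjOn.closure {n : ℕ} {Y : Set (Euc n)} {z p : Euc n} (h : IsProjOn Y z p) :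
    IsProjOn (closure Y) z p := by
  refine ⟨subset_closure h.1, fun q hq => ?_⟩
  have hcl : IsClosed {q : Euc n | ‖z - p‖ ≤ ‖z - q‖} :=
    isClosed_le continuous_const (by fun_prop)
  exact closure_minimal (fun q hq => h.2 q hq) hcl hq

/-- The feasible set need not be closed, so that not every point has a projection onto it; the
projection onto its closure is defined everywhere and extends the given projections. -/
theorem exists_continuous_proj {n : ℕ} {Y : Set (Euc n)} (hY : Convex ℝ Y) (hne : Y.Nonempty) :
    ∃ P : Euc n → Euc n, Continuous P ∧ (∀ z p, IsProjOn Y z p → p = P z) ∧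
      ∀ z w q, IsProjOn Y w q → ‖P z - q‖ ≤ ‖z - w‖ := by
  have hex : ∀ z, ∃ p, IsProjOn (_root_.closure Y) z p := by
    intro z
    obtain ⟨p, hp, h⟩ := exists_norm_eq_iInf_of_complete_convex hne.closure
      isClosed_closure.isComplete hY.closure z
    exact ⟨p, isProjOn_of_inner_le_zero hp
      ((norm_eq_iInf_iff_real_inner_le_zero hY.closure hp).1 h)⟩
  choose P hP using hex
  refine ⟨P, ?_, ?_, ?_⟩
  · refine (LipschitzWith.of_dist_le_mul (K := 1) fun z w => ?_).continuous
    simpa [dist_eq_norm] using (hP z).norm_sub_le hY.closure (hP w)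
  · intro z p hp
    have h := hp.closure.norm_sub_le hY.closure (hP z)
    rw [sub_self, norm_zero] at h
    exact sub_eq_zero.1 (norm_le_zero_iff.1 h)
  · intro z w q hq
    exact (hP z).norm_sub_le hY.closure hq.closure

/-! ### Geometry of the dual problem -/

section Geometry

variable {d d' : ℕ} {Ξ : Type*} [MeasurableSpace Ξ] {ν : Measure Ξ}
  {Y : Set (Euc d')} {f : Euc d → Euc d' → ℝ} {F : Euc d → ℝ}
  {Ox : Euc d → Euc d' → Ξ → Euc d} {Oy : Euc d → Euc d' → Ξ → Euc d'}
  {Lf LF lam σ ΔF : ℝ} {x0 : Euc d}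

namespace MinMaxAssumption

theorem mem_argmaxSet_iff (H : MinMaxAssumption ν Y f F Ox Oy Lf LF lam σ ΔF x0)
    {x : Euc d} {y : Euc d'} : y ∈ argmaxSet Y f x ↔ y ∈ Y ∧ f x y = F x := by
  refine ⟨fun h => ⟨h.1, le_antisymm ((H.isMax x).2 ⟨y, h.1, rfl⟩) ?_⟩,
    fun h => ⟨h.1, fun y' hy' => h.2 ▸ (H.isMax x).2 ⟨y', hy', rfl⟩⟩⟩
  obtain ⟨z, hz, hzF⟩ := (H.isMax x).1
  exact hzF ▸ h.2 z hz

theorem argmaxSet_nonempty (H : MinMaxAssumption ν Y f F Ox Oy Lf LF lam σ ΔF x0) (x : Euc d) :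
    (argmaxSet Y f x).Nonempty := by
  obtain ⟨z, hz, hzF⟩ := (H.isMax x).1
  exact ⟨z, H.mem_argmaxSet_iff.2 ⟨hz, hzF⟩⟩

theorem nonempty (H : MinMaxAssumption ν Y f F Ox Oy Lf LF lam σ ΔF x0) : Y.Nonempty :=
  let ⟨z, hz⟩ := H.argmaxSet_nonempty x0
  ⟨z, hz.1⟩

theorem convex (H : MinMaxAssumption ν Y f F Ox Oy Lf LF lam σ ΔF x0) : Convex ℝ Y := by
  rcases H.dual with h | h
  · exact h.1
  · rw [h.1]
    exact convex_univ

theorem differentiable_left (H : MinMaxAssumption ν Y f F Ox Oy Lf LF lam σ ΔF x0)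
    (y : Euc d') : Differentiable ℝ fun x => f x y :=
  H.diff_f.comp (differentiable_id.prodMk (differentiable_const y))

theorem differentiable_right (H : MinMaxAssumption ν Y f F Ox Oy Lf LF lam σ ΔF x0)
    (x : Euc d) : Differentiable ℝ (f x) :=
  H.diff_f.comp ((differentiable_const x).prodMk differentiable_id)

/-- The envelope theorem: `F - f(·, y)` is minimal at `x` when `y` maximizes `f(x, ·)`. -/
theorem gradient_eq_gradX (H : MinMaxAssumption ν Y f F Ox Oy Lf LF lam σ ΔF x0)
    {x : Euc d} {y : Euc d'} (hy : y ∈ argmaxSet Y f x) : gradient F x = gradX f x y := by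
  have hmem := H.mem_argmaxSet_iff.1 hy
  have hmin : IsLocalMin (fun x' => F x' - f x' y) x := by
    refine Filter.Eventually.of_forall fun x' => ?_
    have := (H.isMax x').2 ⟨y, hmem.1, rfl⟩
    simp only [hmem.2, sub_self]
    linarith
  have h := hmin.fderiv_eq_zero
  rw [fderiv_fun_sub (H.diff_F x) (H.differentiable_left y x), sub_eq_zero] at h
  rw [gradX, gradient, gradient, h]

theorem norm_gradX_sub_le (H : MinMaxAssumption ν Y f F Ox Oy Lf LF lam σ ΔF x0) (hLf : 0 ≤ Lf)
    (x x' : Euc d) (y y' : Euc d') :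
    ‖gradX f x y - gradX f x' y'‖ ≤ Lf * (‖x - x'‖ + ‖y - y'‖) := by
  refine le_of_sq_le_sq ?_ (by positivity)
  have h := H.lip_f x x' y y'
  have h1 : 0 ≤ Lf ^ 2 * (2 * (‖x - x'‖ * ‖y - y'‖)) := by positivity
  nlinarith [sq_nonneg ‖gradY f x y - gradY f x' y'‖]

theorem norm_gradY_sub_le (H : MinMaxAssumption ν Y f F Ox Oy Lf LF lam σ ΔF x0) (hLf : 0 ≤ Lf)
    (x x' : Euc d) (y y' : Euc d') :
    ‖gradY f x y - gradY f x' y'‖ ≤ Lf * (‖x - x'‖ + ‖y - y'‖) := by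
  refine le_of_sq_le_sq ?_ (by positivity)
  have h := H.lip_f x x' y y'
  have h1 : 0 ≤ Lf ^ 2 * (2 * (‖x - x'‖ * ‖y - y'‖)) := by positivity
  nlinarith [sq_nonneg ‖gradX f x y - gradX f x' y'‖]

theorem inner_gradY_nonpos (H : MinMaxAssumption ν Y f F Ox Oy Lf LF lam σ ΔF x0)
    {x : Euc d} {ys y : Euc d'} (hys : ys ∈ argmaxSet Y f x) (hy : y ∈ Y) :
    inner ℝ (gradY f x ys) (y - ys) ≤ 0 := by
  have hmax : IsMaxOn (f x) Y ys := fun z hz => hys.2 z hz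
  rw [gradY, inner_gradient_left]
  exact hmax.localize.hasFDerivWithinAt_nonpos
    (H.differentiable_right x ys).hasFDerivAt.hasFDerivWithinAt
    (sub_mem_posTangentConeAt_of_segment_subset (H.convex.segment_subset hys.1 hy))

/-- A maximizer is a fixed point of the projected gradient step. -/
theorem isProjOn_argmax (H : MinMaxAssumption ν Y f F Ox Oy Lf LF lam σ ΔF x0)
    {x : Euc d} {ys : Euc d'} (hys : ys ∈ argmaxSet Y f x) {η : ℝ} (hη : 0 ≤ η) :
    IsProjOn Y (ys + η • gradY f x ys) ys := by
  refine isProjOn_of_inner_le_zero hys.1 fun q hq => ?_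
  rw [add_sub_cancel_left, real_inner_smul_left]
  exact mul_nonpos_of_nonneg_of_nonpos hη (H.inner_gradY_nonpos hys hq)

theorem _root_.StronglyConcaveOver.inner_sub_le {n : ℕ} {Y : Set (Euc n)} {lam : ℝ} {g : Euc n → ℝ}
    (h : StronglyConcaveOver Y lam g) {y z : Euc n} (hy : y ∈ Y) (hz : z ∈ Y) :
    inner ℝ (gradient g y - gradient g z) (y - z) ≤ -(lam * ‖y - z‖ ^ 2) := by
  have h1 := h y hy z hz
  have h2 := h z hz y hy
  rw [← neg_sub y z, inner_neg_right, norm_neg] at h2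
  rw [inner_sub_left]
  linarith

theorem infDist_argmax_sq_le_of_pl (H : MinMaxAssumption ν Y f F Ox Oy Lf LF lam σ ΔF x0)
    (hY : Y = Set.univ) (hPL : ∀ x y, 2 * lam * (F x - f x y) ≤ ‖gradY f x y‖ ^ 2)
    (x : Euc d) (y : Euc d') :
    lam / 2 * Metric.infDist y (argmaxSet Y f x) ^ 2 ≤ F x - f x y := by
  have hset : argmaxSet Y f x = {z | f x z = F x} := by
    ext z
    rw [H.mem_argmaxSet_iff, hY]
    simp
  rw [hset]
  exact sq_infDist_le_of_pl (H.differentiable_right x)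
    (fun z => (H.isMax x).2 ⟨z, hY ▸ Set.mem_univ z, rfl⟩) (hPL x) y

/-- The nearest maximizer exists even though `Y` need not be closed: in the strongly concave case
the maximizer is unique, otherwise `Y` is the whole space. -/
theorem exists_infDist_argmax_eq (H : MinMaxAssumption ν Y f F Ox Oy Lf LF lam σ ΔF x0)
    (hlam : 0 < lam) (x : Euc d) (y : Euc d') :
    ∃ ys ∈ argmaxSet Y f x, Metric.infDist y (argmaxSet Y f x) = ‖y - ys‖ := by
  have hcl : IsClosed (argmaxSet Y f x) := by
    rcases H.dual with ⟨-, h⟩ | ⟨hY, -⟩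
    · refine Set.Subsingleton.isClosed fun y1 h1 y2 h2 => ?_
      have e1 := h x y1 h1.1 y2 h2.1
      have e2 := H.inner_gradY_nonpos h2 h1.1
      have e3 := h1.2 y2 h2.1
      rw [gradY] at e2
      have e4 : ‖y1 - y2‖ ^ 2 ≤ 0 := by nlinarith
      have e5 : ‖y1 - y2‖ = 0 := by
        have := sq_nonneg ‖y1 - y2‖
        exact pow_eq_zero_iff two_ne_zero |>.1 (le_antisymm e4 this)
      exact sub_eq_zero.1 (norm_eq_zero.1 e5)
    · have hset : argmaxSet Y f x = {z | f x z = F x} := by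
        ext z
        rw [H.mem_argmaxSet_iff, hY]
        simp
      rw [hset]
      exact isClosed_eq (H.differentiable_right x).continuous continuous_const
  obtain ⟨ys, h1, h2⟩ := hcl.exists_infDist_eq_dist (H.argmaxSet_nonempty x) y
  exact ⟨ys, h1, by rw [h2, dist_eq_norm]⟩

/-- The solution map `x ↦ argmax f(x, ·)` is `Lf / lam`-Lipschitz. -/
theorem infDist_argmax_le (H : MinMaxAssumption ν Y f F Ox Oy Lf LF lam σ ΔF x0)
    (hlam : 0 < lam) (hLf : 0 ≤ Lf) (x x' : Euc d) (y : Euc d') :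
    Metric.infDist y (argmaxSet Y f x')
      ≤ Metric.infDist y (argmaxSet Y f x) + Lf / lam * ‖x' - x‖ := by
  obtain ⟨ys, hys, hd⟩ := H.exists_infDist_argmax_eq hlam x y
  have hkey : Metric.infDist ys (argmaxSet Y f x') ≤ Lf / lam * ‖x' - x‖ := by
    rw [div_mul_eq_mul_div, le_div_iff₀ hlam]
    rcases H.dual with ⟨-, h⟩ | ⟨hY, -, hPL⟩
    · obtain ⟨zs, hzs⟩ := H.argmaxSet_nonempty x'
      have h1 : Metric.infDist ys (argmaxSet Y f x') ≤ ‖zs - ys‖ := by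
        rw [← dist_eq_norm, dist_comm]
        exact Metric.infDist_le_dist_of_mem hzs
      refine (mul_le_mul_of_nonneg_right h1 hlam.le).trans ?_
      have h2 := (h x').inner_sub_le hys.1 hzs.1
      have h3 := H.inner_gradY_nonpos hys hzs.1
      have h4 := H.inner_gradY_nonpos hzs hys.1
      have h5 := real_inner_le_norm (gradY f x' ys - gradY f x ys) (zs - ys)
      have h6 := H.norm_gradY_sub_le hLf x' x ys ys
      have h7 := mul_le_mul_of_nonneg_right h6 (norm_nonneg (zs - ys))
      rw [inner_sub_left] at h2 h5
      rw [← neg_sub zs ys, norm_neg, inner_neg_right, inner_neg_right] at h2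
      rw [← neg_sub zs ys, inner_neg_right] at h4
      rw [sub_self, norm_zero, add_zero] at h7
      simp only [gradY] at h2 h3 h4 h5 h7
      rcases (norm_nonneg (zs - ys)).eq_or_lt with h0 | h0
      · rw [← h0, zero_mul]
        positivity
      · nlinarith
    · have h1 := H.infDist_argmax_sq_le_of_pl hY hPL x' ys
      have h2 := hPL x' ys
      have hz : gradY f x ys = 0 := by
        have := H.inner_gradY_nonpos hys (y := ys + gradY f x ys) (hY ▸ Set.mem_univ _)
        rw [add_sub_cancel_left] at this
        exact real_inner_self_nonpos.1 this
      have h3 := H.norm_gradY_sub_le hLf x' x ys ys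
      rw [hz, sub_zero, sub_self, norm_zero, add_zero] at h3
      refine (le_of_sq_le_sq ?_ (norm_nonneg _)).trans h3
      have h4 := mul_le_mul_of_nonneg_left h1 (by positivity : 0 ≤ 2 * lam)
      nlinarith
  have h1 := Metric.infDist_le_infDist_add_dist (x := y) (y := ys) (s := argmaxSet Y f x')
  rw [hd]
  rw [dist_eq_norm] at h1
  linarith

/-- The distance to the solution set contracts under a gradient step from a feasible point. -/
theorem norm_step_sub_sq_le (H : MinMaxAssumption ν Y f F Ox Oy Lf LF lam σ ΔF x0)
    (hlam : 0 < lam) (hLf : 0 < Lf) {η : ℝ} (hη : 0 < η) (hcap : η ≤ lam / (2 * Lf ^ 2))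
    {x : Euc d} {y ys : Euc d'} (hy : y ∈ Y) (hys : ys ∈ argmaxSet Y f x)
    (hd : Metric.infDist y (argmaxSet Y f x) = ‖y - ys‖) :
    ‖y - ys + η • (gradY f x y - gradY f x ys)‖ ^ 2 ≤ (1 - η * lam / 2) * ‖y - ys‖ ^ 2 := by
  have h1 := H.norm_gradY_sub_le hLf.le x x y ys
  rw [sub_self, norm_zero, zero_add] at h1
  have h2 : ‖gradY f x y - gradY f x ys‖ ^ 2 ≤ Lf ^ 2 * ‖y - ys‖ ^ 2 := by
    rw [← mul_pow]
    gcongr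
  have h3 : inner ℝ (y - ys) (gradY f x y - gradY f x ys) ≤ -(lam / 2 * ‖y - ys‖ ^ 2) := by
    rw [real_inner_comm]
    rcases H.dual with ⟨-, h⟩ | ⟨hY, hc, hPL⟩
    · have := (h x).inner_sub_le hy hys.1
      simp only [gradY]
      nlinarith [sq_nonneg ‖y - ys‖]
    · have e1 := H.infDist_argmax_sq_le_of_pl hY hPL x y
      rw [hd] at e1
      have e2 := (hc x).le_add_inner_gradient (H.differentiable_right x) y ys
      have e3 := (hc x).le_add_inner_gradient (H.differentiable_right x) ys y
      have e4 := H.inner_gradY_nonpos hys (y := ys - (y - ys)) (hY ▸ Set.mem_univ _)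
      rw [(H.mem_argmaxSet_iff.1 hys).2, ← neg_sub y ys, inner_neg_right] at e2
      rw [sub_sub_cancel_left, inner_neg_right] at e4
      rw [inner_sub_left]
      simp only [gradY] at e4 ⊢
      linarith
  rw [norm_add_sq_real, real_inner_smul_right, norm_smul, Real.norm_of_nonneg hη.le]
  have h4 : η * Lf ^ 2 ≤ lam / 2 := by
    rw [le_div_iff₀ (by positivity)] at hcap
    linarith
  have h5 := mul_le_mul_of_nonneg_left h2 hη.le
  have h6 := mul_le_mul_of_nonneg_right h4 (sq_nonneg ‖y - ys‖)
  have h7 : η * (η * ‖gradY f x y - gradY f x ys‖ ^ 2) ≤ η * (lam / 2 * ‖y - ys‖ ^ 2) := by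
    refine mul_le_mul_of_nonneg_left ?_ hη.le
    linarith
  have h8 := mul_le_mul_of_nonneg_left h3 hη.le
  nlinarith

/-- An infeasible starting point loses at most a constant factor in its first gradient step. -/
theorem norm_step_sub_sq_le' (H : MinMaxAssumption ν Y f F Ox Oy Lf LF lam σ ΔF x0)
    (hlam : 0 < lam) (hle : lam ≤ Lf) {η : ℝ} (hη : 0 < η) (hcap : η ≤ lam / (2 * Lf ^ 2))
    (x : Euc d) (y ys : Euc d') :
    ‖y - ys + η • (gradY f x y - gradY f x ys)‖ ^ 2 ≤ 9 / 4 * ‖y - ys‖ ^ 2 := by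
  have hLf : 0 < Lf := hlam.trans_le hle
  have h1 := H.norm_gradY_sub_le hLf.le x x y ys
  rw [sub_self, norm_zero, zero_add] at h1
  have h2 : η * Lf ≤ 1 / 2 := by
    rw [le_div_iff₀ (by positivity)] at hcap
    nlinarith
  have h3 : ‖y - ys + η • (gradY f x y - gradY f x ys)‖ ≤ 3 / 2 * ‖y - ys‖ := by
    refine (norm_add_le _ _).trans ?_
    rw [norm_smul, Real.norm_of_nonneg hη.le]
    have h4 := mul_le_mul_of_nonneg_left h1 hη.le
    have h5 := mul_le_mul_of_nonneg_right h2 (norm_nonneg (y - ys))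
    linarith
  calc _ ≤ (3 / 2 * ‖y - ys‖) ^ 2 := by gcongr
    _ = _ := by ring

end MinMaxAssumption

end Geometry

/-! ### Integrating out a fresh sample -/

/-- If `ξ` is independent of `m` and `w` is `m`-measurable, then `φ (w, ξ)` is integrable with
expectation at most that of `Ψ`, provided `Ψ` bounds the integral of `φ (w, ·)` over the law of
`ξ`. -/
theorem integral_le_of_indep {Ω Ξ W : Type*} {m : MeasurableSpace Ω} [mΩ : MeasurableSpace Ω] [mΞ : MeasurableSpace Ξ]
    [MeasurableSpace W] {μ : Measure Ω} [IsProbabilityMeasure μ] {ν : Measure Ξ}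
    [IsProbabilityMeasure ν] (hm : m ≤ mΩ) {ξ : Ω → Ξ}
    (hξ : Measurable ξ) (hlaw : μ.map ξ = ν) (hind : Indep m (MeasurableSpace.comap ξ mΞ) μ)
    {w : Ω → W} (hw : Measurable[m] w) {φ : W × Ξ → ℝ} (hφ : Measurable φ)
    (hφ0 : ∀ p, 0 ≤ φ p) {Ψ : Ω → ℝ} (hΨ : Integrable Ψ μ)
    (h : ∀ ω, Integrable (fun s => φ (w ω, s)) ν ∧ ∫ s, φ (w ω, s) ∂ν ≤ Ψ ω) :
    Integrable (fun ω => φ (w ω, ξ ω)) μ ∧ ∫ ω, φ (w ω, ξ ω) ∂μ ≤ ∫ ω, Ψ ω ∂μ := by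
  have hwm : Measurable w := hw.mono hm le_rfl
  have hindep : IndepFun w ξ μ := by
    rw [IndepFun_iff_Indep]
    exact indep_of_indep_of_le_left hind hw.comap_le
  have hmap := (indepFun_iff_map_prod_eq_prod_map_map hwm.aemeasurable hξ.aemeasurable).1 hindep
  have hΨ0 : ∀ ω, 0 ≤ Ψ ω := fun ω => (integral_nonneg fun s => hφ0 _).trans (h ω).2
  have hof : Measurable fun p => ENNReal.ofReal (φ p) := hφ.ennreal_ofReal
  have hlin : ∫⁻ ω, ENNReal.ofReal (φ (w ω, ξ ω)) ∂μ ≤ ∫⁻ ω, ENNReal.ofReal (Ψ ω) ∂μ := by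
    rw [← lintegral_map (g := fun ω => (w ω, ξ ω)) hof (hwm.prodMk hξ), hmap, hlaw,
      lintegral_prod _ hof.aemeasurable, lintegral_map hof.lintegral_prod_right' hwm]
    refine lintegral_mono fun ω => ?_
    rw [← ofReal_integral_eq_lintegral_ofReal (h ω).1 (Filter.Eventually.of_forall fun s => hφ0 _)]
    exact ENNReal.ofReal_le_ofReal (h ω).2
  have hfin : ∫⁻ ω, ENNReal.ofReal (Ψ ω) ∂μ < ⊤ := by
    rw [← ofReal_integral_eq_lintegral_ofReal hΨ (Filter.Eventually.of_forall hΨ0)]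
    exact ENNReal.ofReal_lt_top
  have hmeas : AEStronglyMeasurable (fun ω => φ (w ω, ξ ω)) μ :=
    (hφ.comp (hwm.prodMk hξ)).aestronglyMeasurable
  refine ⟨⟨hmeas, ?_⟩, ?_⟩
  · rw [hasFiniteIntegral_iff_ofReal (Filter.Eventually.of_forall fun ω => hφ0 _)]
    exact hlin.trans_lt hfin
  · rw [integral_eq_lintegral_of_nonneg_ae (Filter.Eventually.of_forall fun ω => hφ0 _) hmeas,
      integral_eq_lintegral_of_nonneg_ae (Filter.Eventually.of_forall hΨ0) hΨ.1]
    exact ENNReal.toReal_mono hfin.ne hlin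

/-- Unbiased noise is orthogonal to a constant. -/
theorem integral_norm_add_smul_sub_sq_le {Ξ : Type*} [MeasurableSpace Ξ] {ν : Measure Ξ}
    [IsProbabilityMeasure ν] {n : ℕ} {X : Ξ → Euc n} {m : Euc n} {σ : ℝ} (hX : MemLp X 2 ν)
    (hm : ∫ s, X s ∂ν = m) (hvar : ∫ s, ‖X s - m‖ ^ 2 ∂ν ≤ σ ^ 2) (a : Euc n) (c : ℝ) :
    Integrable (fun s => ‖a + c • (X s - m)‖ ^ 2) ν ∧
      ∫ s, ‖a + c • (X s - m)‖ ^ 2 ∂ν ≤ ‖a‖ ^ 2 + c ^ 2 * σ ^ 2 := by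
  have hN : MemLp (fun s => X s - m) 2 ν := hX.sub (memLp_const m)
  have hNi : Integrable (fun s => X s - m) ν := hN.integrable one_le_two
  have hN2 : Integrable (fun s => ‖X s - m‖ ^ 2) ν := (memLp_two_iff_integrable_sq_norm hN.1).1 hN
  have hin : Integrable (fun s => inner ℝ a (X s - m)) ν := hNi.const_inner a
  have he : (fun s => ‖a + c • (X s - m)‖ ^ 2) = fun s =>
      (‖a‖ ^ 2 + 2 * c * inner ℝ a (X s - m)) + c ^ 2 * ‖X s - m‖ ^ 2 := by
    funext s
    rw [norm_add_sq_real, real_inner_smul_right, norm_smul, mul_pow, Real.norm_eq_abs, sq_abs]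
    ring
  have hi1 : Integrable (fun s => ‖a‖ ^ 2 + 2 * c * inner ℝ a (X s - m)) ν :=
    (integrable_const _).add (hin.const_mul _)
  rw [he]
  refine ⟨hi1.add (hN2.const_mul _), ?_⟩
  rw [integral_add hi1 (hN2.const_mul _), integral_add (integrable_const _) (hin.const_mul _),
    integral_const_mul, integral_const_mul, integral_inner hNi a,
    integral_sub (hX.integrable one_le_two) (integrable_const _), hm]
  simp only [integral_const, probReal_univ, one_smul, sub_self, inner_zero_right, mul_zero,
    add_zero]
  gcongr

/-! ### Measurability and square integrability of the iterates -/

theorem MeasureTheory.MemLp.integrable_norm_sq {Ω : Type*} [MeasurableSpace Ω] {μ : Measure Ω}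
    {n : ℕ} {X : Ω → Euc n} (hX : MemLp X 2 μ) : Integrable (fun ω => ‖X ω‖ ^ 2) μ :=
  (memLp_two_iff_integrable_sq_norm hX.1).1 hX

section Run

variable {d d' : ℕ} {Ω Ξ : Type*} [mΩ : MeasurableSpace Ω] [mΞ : MeasurableSpace Ξ]
  {μ : Measure Ω} {ν : Measure Ξ}
  {Y : Set (Euc d')} {f : Euc d → Euc d' → ℝ} {F : Euc d → ℝ}
  {Ox : Euc d → Euc d' → Ξ → Euc d} {Oy : Euc d → Euc d' → Ξ → Euc d'}
  {Lf LF lam σ ΔF : ℝ} {x0 : Euc d} {y0 : Ω → Euc d'} {v0 : Ω → Euc d}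
  {ℱ : Filtration ℕ mΩ} {ξ : ℕ → Ω → Ξ}
  {h : (t : ℕ) → Euc d → (Fin (t + 1) → Euc d) → Euc d} {G0 cl cu γ ηx ηy : ℝ}
  {x : ℕ → Ω → Euc d} {y : ℕ → Ω → Euc d'} {u v : ℕ → Ω → Euc d}

theorem continuous_of_norm_sub_le {E : Type*} [NormedAddCommGroup E]
    {g : Euc d → Euc d' → E} {C : ℝ}
    (hg : ∀ x x' y y', ‖g x y - g x' y'‖ ≤ C * (‖x - x'‖ + ‖y - y'‖)) :
    Continuous fun p : Euc d × Euc d' => g p.1 p.2 := by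
  refine (LipschitzWith.of_dist_le_mul (K := (2 * |C|).toNNReal) fun p q => ?_).continuous
  rw [dist_eq_norm, dist_eq_norm, Real.coe_toNNReal _ (by positivity)]
  have h1 : ‖p.1 - q.1‖ ≤ ‖p - q‖ := norm_fst_le (p - q)
  have h2 : ‖p.2 - q.2‖ ≤ ‖p - q‖ := norm_snd_le (p - q)
  calc _ ≤ C * (‖p.1 - q.1‖ + ‖p.2 - q.2‖) := hg p.1 q.1 p.2 q.2
    _ ≤ |C| * (‖p - q‖ + ‖p - q‖) := by
      gcongr
      exact le_abs_self C
    _ = _ := by ring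

theorem MeasureTheory.MemLp.of_norm_sub_le [IsProbabilityMeasure μ] {E : Type*}
    [NormedAddCommGroup E] {g : Euc d → Euc d' → E} {C : ℝ}
    (hg : ∀ x x' y y', ‖g x y - g x' y'‖ ≤ C * (‖x - x'‖ + ‖y - y'‖))
    {a : Ω → Euc d} {b : Ω → Euc d'} (ha : MemLp a 2 μ) (hb : MemLp b 2 μ) :
    MemLp (fun ω => g (a ω) (b ω)) 2 μ := by
  have hsum : MemLp (fun ω => C * (‖a ω‖ + ‖b ω‖) + ‖g 0 0‖) 2 μ :=
    ((ha.norm.add hb.norm).const_mul C).add (memLp_const _)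
  refine hsum.of_le
    ((continuous_of_norm_sub_le hg).comp_aestronglyMeasurable (ha.1.prodMk hb.1)) ?_
  refine Filter.Eventually.of_forall fun ω => ?_
  have h1 := hg (a ω) 0 (b ω) 0
  have h2 := norm_le_norm_add_norm_sub' (g (a ω) (b ω)) (g 0 0)
  rw [sub_zero, sub_zero] at h1
  exact (by linarith : ‖g (a ω) (b ω)‖ ≤ _).trans (le_abs_self _)

/-- A run of the method on an admissible problem, with the parameter conditions that do not
involve the target accuracy. -/
structure IsAdmissibleRun (μ : Measure Ω) (ν : Measure Ξ)
    (Y : Set (Euc d')) (f : Euc d → Euc d' → ℝ) (F : Euc d → ℝ)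
    (Ox : Euc d → Euc d' → Ξ → Euc d) (Oy : Euc d → Euc d' → Ξ → Euc d')
    (Lf LF lam σ ΔF : ℝ) (x0 : Euc d) (y0 : Ω → Euc d') (v0 : Ω → Euc d)
    (ℱ : Filtration ℕ mΩ) (ξ : ℕ → Ω → Ξ)
    (h : (t : ℕ) → Euc d → (Fin (t + 1) → Euc d) → Euc d) (G0 cl cu γ ηx ηy : ℝ)
    (x : ℕ → Ω → Euc d) (y : ℕ → Ω → Euc d') (u v : ℕ → Ω → Euc d) : Prop where
  problem : MinMaxAssumption ν Y f F Ox Oy Lf LF lam σ ΔF x0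
  sampling : IsSampling μ ν ℱ ξ y0 v0
  meas_h : ∀ t, Measurable (fun p : Euc d × (Fin (t + 1) → Euc d) => h t p.1 p.2)
  run : IsPDAdaRun Y Ox Oy h G0 γ ηx ηy ξ x0 y0 v0 x y u v
  scaling : ScalingBounded μ G0 cl cu u
  cl_pos : 0 < cl
  cl_le : cl ≤ cu
  lam_pos : 0 < lam
  lam_le : lam ≤ Lf
  LF_pos : 0 < LF
  γ_pos : 0 < γ
  ηx_pos : 0 < ηx
  ηy_pos : 0 < ηy
  γ_cap : γ ≤ 1 / 4
  ηx_cap : ηx ≤ cl / (2 * cu ^ 2 * LF)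
  ηy_cap : ηy ≤ lam / (2 * Lf ^ 2)

namespace IsAdmissibleRun

theorem cu_pos (A : IsAdmissibleRun μ ν Y f F Ox Oy Lf LF lam σ ΔF x0 y0 v0 ℱ ξ h G0 cl cu
    γ ηx ηy x y u v) : 0 < cu :=
  A.cl_pos.trans_le A.cl_le

theorem Lf_pos (A : IsAdmissibleRun μ ν Y f F Ox Oy Lf LF lam σ ΔF x0 y0 v0 ℱ ξ h G0 cl cu
    γ ηx ηy x y u v) : 0 < Lf :=
  A.lam_pos.trans_le A.lam_le

theorem ηy_mul_lam_le (A : IsAdmissibleRun μ ν Y f F Ox Oy Lf LF lam σ ΔF x0 y0 v0 ℱ ξ h G0 cl cu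
    γ ηx ηy x y u v) : ηy * lam ≤ 1 / 2 := by
  have hlam := A.lam_pos
  have hLf := A.Lf_pos
  have hcap := A.ηy_cap
  rw [le_div_iff₀ (by positivity)] at hcap
  have hsq : lam * lam ≤ Lf ^ 2 := by
    rw [sq]
    exact mul_self_le_mul_self hlam.le A.lam_le
  have h1 := mul_le_mul_of_nonneg_left hsq A.ηy_pos.le
  nlinarith

theorem measurable_ξ (A : IsAdmissibleRun μ ν Y f F Ox Oy Lf LF lam σ ΔF x0 y0 v0 ℱ ξ h G0 cl cu
    γ ηx ηy x y u v) (t : ℕ) : Measurable (ξ t) :=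
  (A.sampling.meas_ξ t).mono (ℱ.le _) le_rfl

/-- The iterates are adapted. The estimator `v t` is only known at time `t` for `t ≥ 1`, since `v 0`
may depend on the first sample. -/
theorem measurable_iterates (A : IsAdmissibleRun μ ν Y f F Ox Oy Lf LF lam σ ΔF x0 y0 v0 ℱ ξ h G0 cl cu
    γ ηx ηy x y u v) (t : ℕ) :
    (Measurable[ℱ t] (x t) ∧ Measurable[ℱ t] (y t)) ∧
    ∀ j < t, Measurable[ℱ (j + 1)] (fun ω => Ox (x j ω) (y j ω) (ξ j ω)) ∧
      Measurable[ℱ (j + 1)] (v (j + 1)) := by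
  obtain ⟨P, hPc, hP, -⟩ := exists_continuous_proj A.problem.convex A.problem.nonempty
  induction t with
  | zero =>
    refine ⟨⟨?_, ?_⟩, fun j hj => absurd hj (Nat.not_lt_zero j)⟩
    · rw [funext A.run.x_zero]
      exact measurable_const
    · rw [funext A.run.y_zero]
      exact A.sampling.meas_y0
  | succ t ih =>
    obtain ⟨⟨hx, hy⟩, hj⟩ := ih
    have hle : ∀ {i j : ℕ}, i ≤ j → ℱ i ≤ ℱ j := fun hij => ℱ.mono hij
    have hx' : Measurable[ℱ (t + 1)] (x t) := hx.mono (hle t.le_succ) le_rfl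
    have hy' : Measurable[ℱ (t + 1)] (y t) := hy.mono (hle t.le_succ) le_rfl
    have hw := (hx'.prodMk hy').prodMk (A.sampling.meas_ξ t)
    have hOx : Measurable[ℱ (t + 1)] (fun ω => Ox (x t ω) (y t ω) (ξ t ω)) :=
      A.problem.meas_Ox.comp hw
    have hOy : Measurable[ℱ (t + 1)] (fun ω => Oy (x t ω) (y t ω) (ξ t ω)) :=
      A.problem.meas_Oy.comp hw
    have hv0 : Measurable[ℱ (t + 1)] v0 := A.sampling.meas_v0.mono (hle (by omega)) le_rfl
    have hvt : Measurable[ℱ (t + 1)] (v t) := by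
      cases t with
      | zero =>
        rw [funext A.run.v_zero]
        exact hv0
      | succ k => exact (hj k k.lt_succ_self).2.mono (hle (by omega)) le_rfl
    have hv : Measurable[ℱ (t + 1)] (v (t + 1)) := by
      rw [funext (A.run.v_succ t)]
      exact (hvt.const_smul (1 - γ)).add (hOx.const_smul γ)
    have hall : ∀ j < t + 1, Measurable[ℱ (j + 1)] (fun ω => Ox (x j ω) (y j ω) (ξ j ω)) ∧
        Measurable[ℱ (j + 1)] (v (j + 1)) := by
      intro j hjt
      rcases Nat.lt_succ_iff_lt_or_eq.1 hjt with h1 | rfl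
      · exact hj j h1
      · exact ⟨hOx, hv⟩
    have hu : Measurable[ℱ (t + 1)] (u (t + 1)) := by
      rw [funext (A.run.u_succ t)]
      refine (A.meas_h t).comp (hv0.prodMk (@measurable_pi_lambda _ _ _ (ℱ (t + 1)) _ _ fun j => ?_))
      exact (hall j j.2).1.mono (hle (by omega)) le_rfl
    refine ⟨⟨?_, ?_⟩, hall⟩
    · have hcoord : ∀ {z : Ω → Euc d}, Measurable[ℱ (t + 1)] z → ∀ i,
          Measurable[ℱ (t + 1)] fun ω => z ω i := fun hz i =>
        (by fun_prop : Measurable fun z : Euc d => z i).comp hz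
      have he : x (t + 1) = fun ω => WithLp.toLp 2 fun i =>
          x t ω i - ηx * (v (t + 1) ω i / (√(u (t + 1) ω i) + G0)) := by
        funext ω
        ext i
        exact A.run.x_succ t ω i
      rw [he]
      refine (WithLp.measurable_toLp 2 _).comp (@measurable_pi_lambda _ _ _ (ℱ (t + 1)) _ _ fun i => ?_)
      exact (hcoord hx' i).sub (((hcoord hv i).div (((hcoord hu i).sqrt).add_const G0)).const_mul _)
    · have he : y (t + 1) = fun ω => P (y t ω + ηy • Oy (x t ω) (y t ω) (ξ t ω)) :=
        funext fun ω => hP _ _ (A.run.y_succ t ω)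
      rw [he]
      exact hPc.measurable.comp (hy'.add (hOy.const_smul ηy))

theorem measurable_x (A : IsAdmissibleRun μ ν Y f F Ox Oy Lf LF lam σ ΔF x0 y0 v0 ℱ ξ h G0 cl cu
    γ ηx ηy x y u v) (t : ℕ) : Measurable[ℱ t] (x t) := (A.measurable_iterates t).1.1

theorem measurable_y (A : IsAdmissibleRun μ ν Y f F Ox Oy Lf LF lam σ ΔF x0 y0 v0 ℱ ξ h G0 cl cu
    γ ηx ηy x y u v) (t : ℕ) : Measurable[ℱ t] (y t) := (A.measurable_iterates t).1.2

theorem measurable_v_succ (A : IsAdmissibleRun μ ν Y f F Ox Oy Lf LF lam σ ΔF x0 y0 v0 ℱ ξ h G0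
    cl cu γ ηx ηy x y u v) (t : ℕ) : Measurable[ℱ (t + 1)] (v (t + 1)) :=
  ((A.measurable_iterates (t + 1)).2 t t.lt_succ_self).2

theorem ae_norm_step_le (A : IsAdmissibleRun μ ν Y f F Ox Oy Lf LF lam σ ΔF x0 y0 v0 ℱ ξ h G0
    cl cu γ ηx ηy x y u v) :
    ∀ᵐ ω ∂μ, ∀ t, ‖x (t + 1) ω - x t ω‖ ≤ ηx * cu * ‖v (t + 1) ω‖ := by
  filter_upwards [A.scaling] with ω hω t
  have hcu := A.cu_pos
  have hηx := A.ηx_pos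
  refine le_of_sq_le_sq ?_ (by positivity)
  rw [mul_pow, EuclideanSpace.norm_sq_eq, EuclideanSpace.norm_sq_eq, Finset.mul_sum]
  refine Finset.sum_le_sum fun i _ => ?_
  rw [PiLp.sub_apply, A.run.x_succ, Real.norm_eq_abs, Real.norm_eq_abs, sq_abs, sq_abs]
  obtain ⟨h1, h2⟩ := hω t i
  have h3 : (1 / (√(u (t + 1) ω i) + G0)) ^ 2 ≤ cu ^ 2 := by
    have := A.cl_pos.trans_le h1
    gcongr
  calc _ = ηx ^ 2 * v (t + 1) ω i ^ 2 * (1 / (√(u (t + 1) ω i) + G0)) ^ 2 := by ring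
    _ ≤ ηx ^ 2 * v (t + 1) ω i ^ 2 * cu ^ 2 := by gcongr
    _ = _ := by ring

theorem memLp_gradX [IsProbabilityMeasure μ] (A : IsAdmissibleRun μ ν Y f F Ox Oy Lf LF lam σ ΔF
    x0 y0 v0 ℱ ξ h G0 cl cu γ ηx ηy x y u v) {a : Ω → Euc d} {b : Ω → Euc d'} (ha : MemLp a 2 μ)
    (hb : MemLp b 2 μ) : MemLp (fun ω => gradX f (a ω) (b ω)) 2 μ :=
  MemLp.of_norm_sub_le (A.problem.norm_gradX_sub_le A.Lf_pos.le) ha hb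

theorem memLp_gradY [IsProbabilityMeasure μ] (A : IsAdmissibleRun μ ν Y f F Ox Oy Lf LF lam σ ΔF
    x0 y0 v0 ℱ ξ h G0 cl cu γ ηx ηy x y u v) {a : Ω → Euc d} {b : Ω → Euc d'} (ha : MemLp a 2 μ)
    (hb : MemLp b 2 μ) : MemLp (fun ω => gradY f (a ω) (b ω)) 2 μ :=
  MemLp.of_norm_sub_le (A.problem.norm_gradY_sub_le A.Lf_pos.le) ha hb

theorem memLp_gradient [IsProbabilityMeasure μ] (A : IsAdmissibleRun μ ν Y f F Ox Oy Lf LF lam σ ΔF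
    x0 y0 v0 ℱ ξ h G0 cl cu γ ηx ηy x y u v) {a : Ω → Euc d} (ha : MemLp a 2 μ) :
    MemLp (fun ω => gradient F (a ω)) 2 μ :=
  MemLp.of_norm_sub_le (d' := d) (g := fun x _ => gradient F x) (C := LF)
    (fun x x' _ _ => (A.problem.lip_F x x').trans
      (mul_le_mul_of_nonneg_left (le_add_of_nonneg_right (norm_nonneg _)) A.LF_pos.le)) ha ha

/-- Square integrability of an oracle value, from that of its mean and the variance bound. -/
theorem memLp_oracle [IsProbabilityMeasure μ] [IsProbabilityMeasure ν] {n : ℕ}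
    {O : Euc d → Euc d' → Ξ → Euc n} {g : Euc d → Euc d' → Euc n}
    (A : IsAdmissibleRun μ ν Y f F Ox Oy Lf LF lam σ ΔF x0 y0 v0 ℱ ξ h G0 cl cu γ ηx ηy x y u v)
    (hmeas : Measurable (fun p : (Euc d × Euc d') × Ξ => O p.1.1 p.1.2 p.2))
    (hmem : ∀ x y, MemLp (O x y) 2 ν) (hmean : ∀ x y, ∫ s, O x y s ∂ν = g x y)
    (hvar : ∀ x y, ∫ s, ‖O x y s - g x y‖ ^ 2 ∂ν ≤ σ ^ 2) (t : ℕ)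
    (hg : MemLp (fun ω => g (x t ω) (y t ω)) 2 μ) :
    MemLp (fun ω => O (x t ω) (y t ω) (ξ t ω)) 2 μ := by
  have hw := (A.measurable_x t).prodMk (A.measurable_y t)
  have hm : Measurable (fun ω => O (x t ω) (y t ω) (ξ t ω)) :=
    hmeas.comp ((hw.mono (ℱ.le t) le_rfl).prodMk (A.measurable_ξ t))
  rw [memLp_two_iff_integrable_sq_norm hm.aestronglyMeasurable]
  refine (integral_le_of_indep (ℱ.le t) (A.measurable_ξ t) (A.sampling.law_ξ t)
    (A.sampling.indep_ξ t) hw (φ := fun p => ‖O p.1.1 p.1.2 p.2‖ ^ 2) (hmeas.norm.pow_const 2)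
    (fun p => by positivity) (Ψ := fun ω => ‖g (x t ω) (y t ω)‖ ^ 2 + 1 ^ 2 * σ ^ 2)
    (hg.integrable_norm_sq.add (integrable_const _)) fun ω => ?_).1
  simpa using integral_norm_add_smul_sub_sq_le (hmem (x t ω) (y t ω)) (hmean _ _) (hvar _ _)
    (g (x t ω) (y t ω)) 1

theorem memLp_iterates [IsProbabilityMeasure μ] [IsProbabilityMeasure ν]
    (A : IsAdmissibleRun μ ν Y f F Ox Oy Lf LF lam σ ΔF x0 y0 v0 ℱ ξ h G0 cl cu γ ηx ηy x y u v)
    (t : ℕ) : MemLp (x t) 2 μ ∧ MemLp (y t) 2 μ ∧ MemLp (v t) 2 μ := by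
  induction t with
  | zero =>
    refine ⟨?_, ?_, ?_⟩
    · rw [funext A.run.x_zero]
      exact memLp_const _
    · rw [funext A.run.y_zero]
      exact A.sampling.memLp_y0
    · rw [funext A.run.v_zero]
      exact A.sampling.memLp_v0
  | succ t ih =>
    obtain ⟨hx, hy, hv⟩ := ih
    have hOx := A.memLp_oracle A.problem.meas_Ox A.problem.memLp_Ox A.problem.mean_Ox
      A.problem.var_Ox t (A.memLp_gradX hx hy)
    have hOy := A.memLp_oracle A.problem.meas_Oy A.problem.memLp_Oy A.problem.mean_Oy
      A.problem.var_Oy t (A.memLp_gradY hx hy)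
    have hv' : MemLp (v (t + 1)) 2 μ := by
      rw [funext (A.run.v_succ t)]
      exact (hv.const_smul (1 - γ)).add (hOx.const_smul γ)
    have hxm : Measurable (x (t + 1)) := (A.measurable_x (t + 1)).mono (ℱ.le _) le_rfl
    have hym : Measurable (y (t + 1)) := (A.measurable_y (t + 1)).mono (ℱ.le _) le_rfl
    refine ⟨?_, ?_, hv'⟩
    · have hstep : MemLp (fun ω => x (t + 1) ω - x t ω) 2 μ := by
        refine hv'.of_le_mul (c := ηx * cu) (hxm.aestronglyMeasurable.sub hx.1) ?_
        filter_upwards [A.ae_norm_step_le] with ω hω using hω t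
      have := hx.add hstep
      refine this.ae_eq (Filter.Eventually.of_forall fun ω => ?_)
      simp
    · obtain ⟨q, hq⟩ := A.problem.nonempty
      have hz : MemLp (fun ω => y t ω + ηy • Oy (x t ω) (y t ω) (ξ t ω) - q) 2 μ :=
        (hy.add (hOy.const_smul ηy)).sub (memLp_const q)
      have hq' : IsProjOn Y q q := ⟨hq, fun _ _ => by simp⟩
      have hsub : MemLp (fun ω => y (t + 1) ω - q) 2 μ := by
        refine hz.of_le (hym.aestronglyMeasurable.sub aestronglyMeasurable_const) ?_
        exact Filter.Eventually.of_forall fun ω =>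
          (A.run.y_succ t ω).norm_sub_le A.problem.convex hq'
      have := hsub.add (memLp_const q)
      refine this.ae_eq (Filter.Eventually.of_forall fun ω => ?_)
      simp

end IsAdmissibleRun

end Run

/-! ### One-step inequalities -/

theorem add_sq_le_young {a b c : ℝ} (hc : 0 < c) :
    (a + b) ^ 2 ≤ (1 + c) * a ^ 2 + (1 + 1 / c) * b ^ 2 := by
  have h : (1 + c) * a ^ 2 + (1 + 1 / c) * b ^ 2 - (a + b) ^ 2 = (c * a - b) ^ 2 / c := by
    field_simp
    ring
  have h2 : 0 ≤ (c * a - b) ^ 2 / c := by positivity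
  linarith

theorem norm_add_sq_le_two {n : ℕ} (a b : Euc n) :
    ‖a + b‖ ^ 2 ≤ 2 * ‖a‖ ^ 2 + 2 * ‖b‖ ^ 2 := by
  have h := norm_add_le a b
  have h1 : ‖a + b‖ ^ 2 ≤ (‖a‖ + ‖b‖) ^ 2 := by gcongr
  nlinarith [sq_nonneg (‖a‖ - ‖b‖)]

theorem norm_momentum_sub_sq_le {n : ℕ} {γ : ℝ} (hγ : 0 < γ) (hγ1 : γ ≤ 1)
    (v g G G' : Euc n) :
    ‖(1 - γ) • v + γ • g - G‖ ^ 2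
      ≤ (1 - γ / 2) * ‖v - G'‖ ^ 2 + 2 / γ * ‖G' - G‖ ^ 2 + γ * ‖g - G‖ ^ 2 := by
  have h1 : ‖(1 - γ) • v + γ • g - G‖ ≤ (1 - γ) * ‖v - G‖ + γ * ‖g - G‖ := by
    have e : (1 - γ) • v + γ • g - G = (1 - γ) • (v - G) + γ • (g - G) := by module
    rw [e]
    refine (norm_add_le _ _).trans ?_
    rw [norm_smul, norm_smul, Real.norm_of_nonneg hγ.le, Real.norm_of_nonneg (by linarith)]
  have h2 : ‖(1 - γ) • v + γ • g - G‖ ^ 2 ≤ (1 - γ) * ‖v - G‖ ^ 2 + γ * ‖g - G‖ ^ 2 := by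
    have h3 : ‖(1 - γ) • v + γ • g - G‖ ^ 2 ≤ ((1 - γ) * ‖v - G‖ + γ * ‖g - G‖) ^ 2 := by gcongr
    have h4 : 0 ≤ γ * (1 - γ) * (‖v - G‖ - ‖g - G‖) ^ 2 :=
      mul_nonneg (mul_nonneg hγ.le (by linarith)) (sq_nonneg _)
    nlinarith
  have h5 : ‖v - G‖ ^ 2 ≤ (1 + γ / 2) * ‖v - G'‖ ^ 2 + (1 + 1 / (γ / 2)) * ‖G' - G‖ ^ 2 := by
    refine le_trans ?_ (add_sq_le_young (by positivity))
    gcongr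
    exact norm_sub_le_norm_sub_add_norm_sub v G' G
  have h6 := mul_le_mul_of_nonneg_left h5 (by linarith : 0 ≤ 1 - γ)
  have h7 : (1 - γ) * (1 + γ / 2) ≤ 1 - γ / 2 := by nlinarith
  have h8 : (1 - γ) * (1 + 1 / (γ / 2)) ≤ 2 / γ := by
    rw [← sub_nonneg]
    have : 2 / γ - (1 - γ) * (1 + 1 / (γ / 2)) = 1 + γ := by
      field_simp
      ring
    linarith
  have h9 := mul_le_mul_of_nonneg_right h7 (sq_nonneg ‖v - G'‖)
  have h10 := mul_le_mul_of_nonneg_right h8 (sq_nonneg ‖G' - G‖)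
  linarith

/-- Descent for a step along `v` that is scaled coordinatewise by factors in `[cl, cu]`. -/
theorem descent_of_scaled_step {n : ℕ} {F : Euc n → ℝ} {L η cl cu : ℝ}
    (hF : Differentiable ℝ F)
    (hL : ∀ x x', ‖gradient F x - gradient F x'‖ ≤ L * ‖x - x'‖) (hL0 : 0 ≤ L)
    (hη : 0 ≤ η) (hcl : 0 ≤ cl) (hcap : η * (cu ^ 2 * L) ≤ cl / 2) {x x' v : Euc n}
    {s : Fin n → ℝ} (hs : ∀ i, cl ≤ s i ∧ s i ≤ cu)
    (hx' : ∀ i, x' i = x i - η * (s i * v i)) :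
    F x' + η * cl / 2 * ‖gradient F x‖ ^ 2 + η * cl / 4 * ‖v‖ ^ 2
      ≤ F x + η * cu / 2 * ‖v - gradient F x‖ ^ 2 := by
  have h := le_add_inner_gradient_add_sq hF hL x x'
  set g := gradient F x with hg
  have hsum : inner ℝ g (x' - x) + L / 2 * ‖x' - x‖ ^ 2 + η * cl / 2 * ‖g‖ ^ 2
      + η * cl / 4 * ‖v‖ ^ 2 ≤ η * cu / 2 * ‖v - g‖ ^ 2 := by
    simp only [PiLp.inner_apply, EuclideanSpace.norm_sq_eq, Finset.mul_sum,
      ← Finset.sum_add_distrib]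
    refine Finset.sum_le_sum fun i _ => ?_
    simp only [PiLp.sub_apply, hx', Real.norm_eq_abs, sq_abs, RCLike.inner_apply, conj_trivial]
    obtain ⟨h1, h2⟩ := hs i
    have e1 : s i * (v i - g i) ^ 2 ≤ cu * (v i - g i) ^ 2 :=
      mul_le_mul_of_nonneg_right h2 (sq_nonneg _)
    have e2 : cl * (g i ^ 2 + v i ^ 2) ≤ s i * (g i ^ 2 + v i ^ 2) :=
      mul_le_mul_of_nonneg_right h1 (by positivity)
    have e3 : s i ^ 2 ≤ cu ^ 2 := by
      have := hcl.trans h1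
      gcongr
    have e4 : η * (s i ^ 2 * L) ≤ cl / 2 := le_trans (by gcongr) hcap
    have e5 := mul_le_mul_of_nonneg_right e4 (mul_nonneg hη (sq_nonneg (v i)))
    have e6 := mul_le_mul_of_nonneg_left e1 hη
    have e7 := mul_le_mul_of_nonneg_left e2 hη
    nlinarith
  linarith

theorem mul_sum_range_succ_le {a b : ℕ → ℝ} {r : ℝ} (hr : r ≤ 1) (ha : ∀ t, 0 ≤ a t)
    (h : ∀ t, a (t + 1) ≤ (1 - r) * a t + b t) (T : ℕ) :
    r * ∑ t ∈ Finset.range (T + 1), a t ≤ a 0 + ∑ t ∈ Finset.range T, b t := by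
  have key : a T + r * ∑ t ∈ Finset.range T, a t ≤ a 0 + ∑ t ∈ Finset.range T, b t := by
    induction T with
    | zero => simp
    | succ T ih =>
      rw [Finset.sum_range_succ, Finset.sum_range_succ]
      linarith [h T]
  rw [Finset.sum_range_succ]
  nlinarith [ha T]

/-! ### Recursions for the expected errors -/

section Run

variable {d d' : ℕ} {Ω Ξ : Type*} [mΩ : MeasurableSpace Ω] [mΞ : MeasurableSpace Ξ]
  {μ : Measure Ω} {ν : Measure Ξ}
  {Y : Set (Euc d')} {f : Euc d → Euc d' → ℝ} {F : Euc d → ℝ}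
  {Ox : Euc d → Euc d' → Ξ → Euc d} {Oy : Euc d → Euc d' → Ξ → Euc d'}
  {Lf LF lam σ ΔF : ℝ} {x0 : Euc d} {y0 : Ω → Euc d'} {v0 : Ω → Euc d}
  {ℱ : Filtration ℕ mΩ} {ξ : ℕ → Ω → Ξ}
  {h : (t : ℕ) → Euc d → (Fin (t + 1) → Euc d) → Euc d} {G0 cl cu γ ηx ηy : ℝ}
  {x : ℕ → Ω → Euc d} {y : ℕ → Ω → Euc d'} {u v : ℕ → Ω → Euc d}

theorem MinMaxAssumption.abs_infDist_argmax_sub_le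
    (H : MinMaxAssumption ν Y f F Ox Oy Lf LF lam σ ΔF x0) (hlam : 0 < lam) (hLf : 0 ≤ Lf)
    (x x' : Euc d) (y y' : Euc d') :
    ‖Metric.infDist y (argmaxSet Y f x) - Metric.infDist y' (argmaxSet Y f x')‖
      ≤ (1 + Lf / lam) * (‖x - x'‖ + ‖y - y'‖) := by
  have h1 := H.infDist_argmax_le hlam hLf x x' y'
  have h2 := H.infDist_argmax_le hlam hLf x' x y
  have h3 := Metric.infDist_le_infDist_add_dist (x := y') (y := y) (s := argmaxSet Y f x)
  have h4 := Metric.infDist_le_infDist_add_dist (x := y) (y := y') (s := argmaxSet Y f x')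
  rw [dist_eq_norm] at h3 h4
  rw [norm_sub_rev] at h1 h3
  have h5 : 0 ≤ Lf / lam * ‖y - y'‖ := by positivity
  have h6 := norm_nonneg (x - x')
  rw [Real.norm_eq_abs, abs_le]
  constructor <;> nlinarith

theorem MinMaxAssumption.norm_gradX_sub_gradient_sq_le
    (H : MinMaxAssumption ν Y f F Ox Oy Lf LF lam σ ΔF x0) (hlam : 0 < lam) (hLf : 0 ≤ Lf)
    (x : Euc d) (y : Euc d') :
    ‖gradX f x y - gradient F x‖ ^ 2 ≤ Lf ^ 2 * Metric.infDist y (argmaxSet Y f x) ^ 2 := by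
  obtain ⟨ys, hys, hd⟩ := H.exists_infDist_argmax_eq hlam x y
  have h1 := H.norm_gradX_sub_le hLf x x y ys
  rw [sub_self, norm_zero, zero_add] at h1
  rw [H.gradient_eq_gradX hys, hd, ← mul_pow]
  gcongr

/-- The noise of the projected ascent step costs at most `η² σ²` in squared distance. -/
theorem MinMaxAssumption.integral_infDist_proj_step_le [IsProbabilityMeasure ν]
    (H : MinMaxAssumption ν Y f F Ox Oy Lf LF lam σ ΔF x0) {η : ℝ} (hη : 0 ≤ η)
    {P : Euc d' → Euc d'} (hPc : Continuous P)
    (hP : ∀ z w q, IsProjOn Y w q → ‖P z - q‖ ≤ ‖z - w‖) (x : Euc d) (y : Euc d') {ys : Euc d'}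
    (hys : ys ∈ argmaxSet Y f x) :
    Integrable (fun s => Metric.infDist (P (y + η • Oy x y s)) (argmaxSet Y f x) ^ 2) ν ∧
      ∫ s, Metric.infDist (P (y + η • Oy x y s)) (argmaxSet Y f x) ^ 2 ∂ν
        ≤ ‖y - ys + η • (gradY f x y - gradY f x ys)‖ ^ 2 + η ^ 2 * σ ^ 2 := by
  obtain ⟨hi, hle⟩ := integral_norm_add_smul_sub_sq_le (H.memLp_Oy x y) (H.mean_Oy x y)
    (H.var_Oy x y) (y - ys + η • (gradY f x y - gradY f x ys)) η
  have hpt : ∀ s, Metric.infDist (P (y + η • Oy x y s)) (argmaxSet Y f x) ^ 2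
      ≤ ‖y - ys + η • (gradY f x y - gradY f x ys) + η • (Oy x y s - gradY f x y)‖ ^ 2 := by
    intro s
    have h1 := hP (y + η • Oy x y s) _ _ (H.isProjOn_argmax hys hη)
    have h2 := Metric.infDist_le_dist_of_mem (x := P (y + η • Oy x y s)) hys
    rw [dist_eq_norm] at h2
    have e : y + η • Oy x y s - (ys + η • gradY f x ys)
        = y - ys + η • (gradY f x y - gradY f x ys) + η • (Oy x y s - gradY f x y) := by module
    rw [e] at h1
    exact pow_le_pow_left₀ Metric.infDist_nonneg (h2.trans h1) 2
  have hc : Continuous fun z => Metric.infDist (P (y + η • z)) (argmaxSet Y f x) ^ 2 :=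
    ((Metric.continuous_infDist_pt _).comp (hPc.comp (by fun_prop))).pow 2
  have hint : Integrable
      (fun s => Metric.infDist (P (y + η • Oy x y s)) (argmaxSet Y f x) ^ 2) ν :=
    hi.mono' (hc.comp_aestronglyMeasurable (H.memLp_Oy x y).1)
      (Filter.Eventually.of_forall fun s => by
        rw [Real.norm_of_nonneg (sq_nonneg _)]
        exact hpt s)
  exact ⟨hint, (integral_mono hint hi hpt).trans hle⟩

namespace IsAdmissibleRun

theorem integrable_primalErrStar [IsProbabilityMeasure μ] [IsProbabilityMeasure ν]
    (A : IsAdmissibleRun μ ν Y f F Ox Oy Lf LF lam σ ΔF x0 y0 v0 ℱ ξ h G0 cl cu γ ηx ηy x y u v)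
    (t : ℕ) : Integrable (primalErrStar F x v t) μ :=
  ((A.memLp_iterates (t + 1)).2.2.sub (A.memLp_gradient (A.memLp_iterates t).1)).integrable_norm_sq

theorem integrable_primalErr [IsProbabilityMeasure μ] [IsProbabilityMeasure ν]
    (A : IsAdmissibleRun μ ν Y f F Ox Oy Lf LF lam σ ΔF x0 y0 v0 ℱ ξ h G0 cl cu γ ηx ηy x y u v)
    (t : ℕ) : Integrable (primalErr f x y v t) μ :=
  ((A.memLp_iterates (t + 1)).2.2.sub
    (A.memLp_gradX (A.memLp_iterates t).1 (A.memLp_iterates t).2.1)).integrable_norm_sq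

theorem integrable_dualErr [IsProbabilityMeasure μ] [IsProbabilityMeasure ν]
    (A : IsAdmissibleRun μ ν Y f F Ox Oy Lf LF lam σ ΔF x0 y0 v0 ℱ ξ h G0 cl cu γ ηx ηy x y u v)
    (t : ℕ) : Integrable (dualErr Y f x y t) μ :=
  (MemLp.of_norm_sub_le (A.problem.abs_infDist_argmax_sub_le A.lam_pos A.Lf_pos.le)
    (A.memLp_iterates t).1 (A.memLp_iterates t).2.1).integrable_sq

theorem integral_primalErrStar_succ_le [IsProbabilityMeasure μ] [IsProbabilityMeasure ν]
    (A : IsAdmissibleRun μ ν Y f F Ox Oy Lf LF lam σ ΔF x0 y0 v0 ℱ ξ h G0 cl cu γ ηx ηy x y u v)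
    (t : ℕ) :
    ∫ ω, primalErrStar F x v (t + 1) ω ∂μ ≤ (1 - γ / 2) * ∫ ω, primalErrStar F x v t ω ∂μ
      + (2 / γ * (LF ^ 2 * (ηx * cu) ^ 2) * ∫ ω, ‖v (t + 1) ω‖ ^ 2 ∂μ
      + γ * Lf ^ 2 * ∫ ω, dualErr Y f x y (t + 1) ω ∂μ + γ ^ 2 * σ ^ 2) := by
  have hγ := A.γ_pos
  have hV := (A.memLp_iterates (t + 1)).2.2.integrable_norm_sq
  set B : Ω → ℝ := fun ω => (1 - γ / 2) * primalErrStar F x v t ω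
    + 2 / γ * ‖gradient F (x t ω) - gradient F (x (t + 1) ω)‖ ^ 2
    + γ * Lf ^ 2 * dualErr Y f x y (t + 1) ω + γ ^ 2 * σ ^ 2 with hB
  have hi2 : Integrable (fun ω => ‖gradient F (x t ω) - gradient F (x (t + 1) ω)‖ ^ 2) μ :=
    ((A.memLp_gradient (A.memLp_iterates t).1).sub
      (A.memLp_gradient (A.memLp_iterates (t + 1)).1)).integrable_norm_sq
  have hBi : Integrable B μ :=
    ((((A.integrable_primalErrStar t).const_mul _).add (hi2.const_mul _)).add
      ((A.integrable_dualErr (t + 1)).const_mul _)).add (integrable_const _)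
  have hgF : Continuous (gradient F) := by
    have hc := continuous_of_norm_sub_le (d' := d) (g := fun x _ => gradient F x) (C := LF)
      fun x x' _ _ => (A.problem.lip_F x x').trans
        (mul_le_mul_of_nonneg_left (le_add_of_nonneg_right (norm_nonneg _)) A.LF_pos.le)
    exact hc.comp (continuous_id.prodMk (continuous_const (y := (0 : Euc d))))
  have hw := (A.measurable_v_succ t).prodMk
    ((A.measurable_x (t + 1)).prodMk (A.measurable_y (t + 1)))
  have hφ : Measurable fun p : (Euc d × Euc d × Euc d') × Ξ =>
      ‖(1 - γ) • p.1.1 + γ • Ox p.1.2.1 p.1.2.2 p.2 - gradient F p.1.2.1‖ ^ 2 := by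
    have h1 : Measurable fun p : (Euc d × Euc d × Euc d') × Ξ => Ox p.1.2.1 p.1.2.2 p.2 :=
      A.problem.meas_Ox.comp ((measurable_fst.snd).prodMk measurable_snd)
    exact (((measurable_fst.fst.const_smul (1 - γ)).add (h1.const_smul γ)).sub
      (hgF.measurable.comp measurable_fst.snd.fst)).norm.pow_const 2
  have hstep := integral_le_of_indep (ℱ.le (t + 1)) (A.measurable_ξ (t + 1))
    (A.sampling.law_ξ (t + 1)) (A.sampling.indep_ξ (t + 1)) hw hφ (fun p => by positivity) hBi
    (fun ω => by
      have h1 := integral_norm_add_smul_sub_sq_le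
        (A.problem.memLp_Ox (x (t + 1) ω) (y (t + 1) ω)) (A.problem.mean_Ox _ _)
        (A.problem.var_Ox _ _) ((1 - γ) • v (t + 1) ω
          + γ • gradX f (x (t + 1) ω) (y (t + 1) ω) - gradient F (x (t + 1) ω)) γ
      have e : ∀ s, (1 - γ) • v (t + 1) ω + γ • Ox (x (t + 1) ω) (y (t + 1) ω) s
          - gradient F (x (t + 1) ω) = (1 - γ) • v (t + 1) ω
          + γ • gradX f (x (t + 1) ω) (y (t + 1) ω) - gradient F (x (t + 1) ω)
          + γ • (Ox (x (t + 1) ω) (y (t + 1) ω) s - gradX f (x (t + 1) ω) (y (t + 1) ω)) :=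
        fun s => by module
      simp only [e]
      refine ⟨h1.1, h1.2.trans ?_⟩
      have h2 := norm_momentum_sub_sq_le hγ (A.γ_cap.trans (by norm_num)) (v (t + 1) ω)
        (gradX f (x (t + 1) ω) (y (t + 1) ω)) (gradient F (x (t + 1) ω)) (gradient F (x t ω))
      have h3 := A.problem.norm_gradX_sub_gradient_sq_le A.lam_pos A.Lf_pos.le
        (x (t + 1) ω) (y (t + 1) ω)
      have h4 := mul_le_mul_of_nonneg_left h3 hγ.le
      simp only [hB, primalErrStar, dualErr]
      linarith)
  have hleft : ∫ ω, primalErrStar F x v (t + 1) ω ∂μ ≤ ∫ ω, B ω ∂μ := by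
    refine le_trans (le_of_eq ?_) hstep.2
    refine integral_congr_ae (Filter.Eventually.of_forall fun ω => ?_)
    simp only [primalErrStar, A.run.v_succ (t + 1)]
  refine hleft.trans ?_
  have hd1 := (A.integrable_primalErrStar t).const_mul (1 - γ / 2)
  have hd2 := hV.const_mul (2 / γ * (LF ^ 2 * (ηx * cu) ^ 2))
  have hd3 := (A.integrable_dualErr (t + 1)).const_mul (γ * Lf ^ 2)
  have hd23 : Integrable (fun ω => 2 / γ * (LF ^ 2 * (ηx * cu) ^ 2) * ‖v (t + 1) ω‖ ^ 2
      + γ * Lf ^ 2 * dualErr Y f x y (t + 1) ω) μ := hd2.add hd3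
  have hd234 : Integrable (fun ω => 2 / γ * (LF ^ 2 * (ηx * cu) ^ 2) * ‖v (t + 1) ω‖ ^ 2
      + γ * Lf ^ 2 * dualErr Y f x y (t + 1) ω + γ ^ 2 * σ ^ 2) μ :=
    hd23.add (integrable_const _)
  have hmono : ∫ ω, B ω ∂μ ≤ ∫ ω, ((1 - γ / 2) * primalErrStar F x v t ω
      + (2 / γ * (LF ^ 2 * (ηx * cu) ^ 2) * ‖v (t + 1) ω‖ ^ 2
        + γ * Lf ^ 2 * dualErr Y f x y (t + 1) ω + γ ^ 2 * σ ^ 2)) ∂μ := by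
    refine integral_mono_ae hBi (hd1.add hd234) ?_
    filter_upwards [A.ae_norm_step_le] with ω hω
    have h1 : ‖gradient F (x t ω) - gradient F (x (t + 1) ω)‖
        ≤ LF * (ηx * cu * ‖v (t + 1) ω‖) := by
      rw [norm_sub_rev]
      exact (A.problem.lip_F _ _).trans (mul_le_mul_of_nonneg_left (hω t) A.LF_pos.le)
    have h2 : ‖gradient F (x t ω) - gradient F (x (t + 1) ω)‖ ^ 2
        ≤ LF ^ 2 * (ηx * cu) ^ 2 * ‖v (t + 1) ω‖ ^ 2 := by
      rw [← mul_pow, ← mul_pow, mul_assoc]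
      gcongr
    have h3 := mul_le_mul_of_nonneg_left h2 (by positivity : 0 ≤ 2 / γ)
    simp only [hB]
    linarith
  rwa [integral_add hd1 hd234, integral_add hd23 (integrable_const _), integral_add hd2 hd3, integral_const_mul, integral_const_mul, integral_const_mul,
    integral_const, probReal_univ, one_smul] at hmono

/-- One projected ascent step with a noisy gradient, measured against the maximizers at the old
`x`. The factor for `t = 0` is larger because the starting point need not lie in `Y`. -/
theorem integral_infDist_succ_le [IsProbabilityMeasure μ] [IsProbabilityMeasure ν]
    (A : IsAdmissibleRun μ ν Y f F Ox Oy Lf LF lam σ ΔF x0 y0 v0 ℱ ξ h G0 cl cu γ ηx ηy x y u v)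
    (t : ℕ) :
    Integrable (fun ω => Metric.infDist (y (t + 1) ω) (argmaxSet Y f (x t ω)) ^ 2) μ ∧
    ∫ ω, Metric.infDist (y (t + 1) ω) (argmaxSet Y f (x t ω)) ^ 2 ∂μ
      ≤ (if t = 0 then 9 / 4 else 1 - ηy * lam / 2) * ∫ ω, dualErr Y f x y t ω ∂μ
        + ηy ^ 2 * σ ^ 2 := by
  have hη := A.ηy_pos
  have hlam := A.lam_pos
  have hLf := A.Lf_pos
  obtain ⟨P, hPc, hP, hPn⟩ := exists_continuous_proj A.problem.convex A.problem.nonempty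
  set c : ℝ := if t = 0 then 9 / 4 else 1 - ηy * lam / 2 with hc
  set g : Euc d → Euc d' → ℝ := fun x y => Metric.infDist y (argmaxSet Y f x) with hg
  have hgc : Continuous fun p : Euc d × Euc d' => g p.1 p.2 :=
    continuous_of_norm_sub_le (A.problem.abs_infDist_argmax_sub_le hlam hLf.le)
  have hw := (A.measurable_x t).prodMk (A.measurable_y t)
  have hφ : Measurable fun p : (Euc d × Euc d') × Ξ =>
      g p.1.1 (P (p.1.2 + ηy • Oy p.1.1 p.1.2 p.2)) ^ 2 := by
    have h1 := A.problem.meas_Oy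
    have h3 : Measurable fun p : (Euc d × Euc d') × Ξ =>
        (p.1.1, P (p.1.2 + ηy • Oy p.1.1 p.1.2 p.2)) :=
      measurable_fst.fst.prodMk (hPc.measurable.comp (measurable_fst.snd.add (h1.const_smul ηy)))
    exact (hgc.measurable.comp h3).pow_const 2
  have hΨ : Integrable (fun ω => c * dualErr Y f x y t ω + ηy ^ 2 * σ ^ 2) μ :=
    ((A.integrable_dualErr t).const_mul c).add (integrable_const _)
  have hpt : ∀ ω, Integrable
      (fun s => g (x t ω) (P (y t ω + ηy • Oy (x t ω) (y t ω) s)) ^ 2) ν ∧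
      ∫ s, g (x t ω) (P (y t ω + ηy • Oy (x t ω) (y t ω) s)) ^ 2 ∂ν
        ≤ c * dualErr Y f x y t ω + ηy ^ 2 * σ ^ 2 := by
    intro ω
    obtain ⟨ys, hys, hd⟩ := A.problem.exists_infDist_argmax_eq hlam (x t ω) (y t ω)
    have h1 := A.problem.integral_infDist_proj_step_le hη.le hPc hPn (x t ω) (y t ω) hys
    refine ⟨h1.1, h1.2.trans (add_le_add ?_ le_rfl)⟩
    rw [dualErr, hd, hc]
    split_ifs with ht
    · exact A.problem.norm_step_sub_sq_le' hlam A.lam_le hη A.ηy_cap _ _ _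
    · obtain ⟨k, rfl⟩ := Nat.exists_eq_succ_of_ne_zero ht
      exact A.problem.norm_step_sub_sq_le hlam hLf hη A.ηy_cap (A.run.y_succ k ω).1 hys hd
  have hstep := integral_le_of_indep (ℱ.le t) (A.measurable_ξ t) (A.sampling.law_ξ t)
    (A.sampling.indep_ξ t) hw hφ (fun p => sq_nonneg _) hΨ hpt
  have hcong : ∀ ω, g (x t ω) (P (y t ω + ηy • Oy (x t ω) (y t ω) (ξ t ω)))
      = g (x t ω) (y (t + 1) ω) := fun ω => by rw [← hP _ _ (A.run.y_succ t ω)]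
  simp only [hcong] at hstep
  refine ⟨hstep.1, ?_⟩
  have h2 := hstep.2
  rwa [integral_add ((A.integrable_dualErr t).const_mul c) (integrable_const _),
    integral_const_mul, integral_const, probReal_univ, one_smul] at h2

theorem integral_dualErr_succ_le [IsProbabilityMeasure μ] [IsProbabilityMeasure ν]
    (A : IsAdmissibleRun μ ν Y f F Ox Oy Lf LF lam σ ΔF x0 y0 v0 ℱ ξ h G0 cl cu γ ηx ηy x y u v)
    (t : ℕ) :
    ∫ ω, dualErr Y f x y (t + 1) ω ∂μ ≤ (1 - ηy * lam / 4) * ∫ ω, dualErr Y f x y t ω ∂μ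
      + ((if t = 0 then 5 * ∫ ω, dualErr Y f x y 0 ω ∂μ else 0) + 2 * (ηy ^ 2 * σ ^ 2)
      + 6 / (ηy * lam) * ((Lf / lam) ^ 2 * (ηx * cu) ^ 2) * ∫ ω, ‖v (t + 1) ω‖ ^ 2 ∂μ) := by
  have hη := A.ηy_pos
  have hlam := A.lam_pos
  have hLf := A.Lf_pos
  have hV := (A.memLp_iterates (t + 1)).2.2.integrable_norm_sq
  have hρ := A.ηy_mul_lam_le
  set κ := Lf / lam with hκ
  have hκ0 : 0 < κ := div_pos hLf hlam
  set α := ηy * lam / 4 with hα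
  have hα0 : 0 < α := by positivity
  have hstep := A.integral_infDist_succ_le t
  set c : ℝ := if t = 0 then 9 / 4 else 1 - ηy * lam / 2 with hc
  have hpt : ∀ᵐ ω ∂μ, dualErr Y f x y (t + 1) ω ≤ (1 + α) * Metric.infDist (y (t + 1) ω) (argmaxSet Y f (x t ω)) ^ 2
      + (1 + 1 / α) * (κ ^ 2 * (ηx * cu) ^ 2) * ‖v (t + 1) ω‖ ^ 2 := by
    filter_upwards [A.ae_norm_step_le] with ω hω
    have h1 := A.problem.infDist_argmax_le hlam hLf.le (x t ω) (x (t + 1) ω) (y (t + 1) ω)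
    have h2 : Metric.infDist (y (t + 1) ω) (argmaxSet Y f (x (t + 1) ω))
        ≤ Metric.infDist (y (t + 1) ω) (argmaxSet Y f (x t ω)) + κ * (ηx * cu * ‖v (t + 1) ω‖) :=
      h1.trans (add_le_add le_rfl (mul_le_mul_of_nonneg_left (hω t) hκ0.le))
    have h3 : dualErr Y f x y (t + 1) ω
        ≤ (Metric.infDist (y (t + 1) ω) (argmaxSet Y f (x t ω)) + κ * (ηx * cu * ‖v (t + 1) ω‖)) ^ 2 := by
      rw [dualErr]
      have := Metric.infDist_nonneg (x := y (t + 1) ω) (s := argmaxSet Y f (x (t + 1) ω))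
      gcongr
    refine h3.trans ((add_sq_le_young hα0).trans (le_of_eq ?_))
    ring
  have hd1 := hstep.1.const_mul (1 + α)
  have hd2 := hV.const_mul ((1 + 1 / α) * (κ ^ 2 * (ηx * cu) ^ 2))
  have h1 := integral_mono_ae (A.integrable_dualErr (t + 1)) (hd1.add hd2) hpt
  simp only [Pi.add_apply] at h1
  rw [integral_add hd1 hd2, integral_const_mul, integral_const_mul] at h1
  have h2 := hstep.2
  have hD : ∀ s, 0 ≤ ∫ ω, dualErr Y f x y s ω ∂μ := fun s =>
    integral_nonneg fun ω => sq_nonneg _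
  have hVn : 0 ≤ ∫ ω, ‖v (t + 1) ω‖ ^ 2 ∂μ := integral_nonneg fun ω => sq_nonneg _
  have hα1 : α ≤ 1 / 8 := by
    rw [hα]
    linarith
  have h3 := mul_le_mul_of_nonneg_left h2 (by positivity : 0 ≤ 1 + α)
  have h4 : 1 + 1 / α ≤ 6 / (ηy * lam) := by
    have e : ηy * lam = 4 * α := by
      rw [hα]
      ring
    rw [e, ← sub_nonneg]
    have e2 : 6 / (4 * α) - (1 + 1 / α) = (1 / 2 - α) / α := by
      field_simp
      ring
    rw [e2]
    exact div_nonneg (by linarith) hα0.le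
  have h5 : (1 + 1 / α) * (κ ^ 2 * (ηx * cu) ^ 2) * ∫ ω, ‖v (t + 1) ω‖ ^ 2 ∂μ
      ≤ 6 / (ηy * lam) * (κ ^ 2 * (ηx * cu) ^ 2) * ∫ ω, ‖v (t + 1) ω‖ ^ 2 ∂μ := by gcongr
  have h6 : (1 + α) * (ηy ^ 2 * σ ^ 2) ≤ 2 * (ηy ^ 2 * σ ^ 2) := by
    gcongr
    linarith
  have h7 : (1 + α) * (c * ∫ ω, dualErr Y f x y t ω ∂μ)
      ≤ (1 - α) * (∫ ω, dualErr Y f x y t ω ∂μ)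
        + if t = 0 then 5 * ∫ ω, dualErr Y f x y 0 ω ∂μ else 0 := by
    rw [← mul_assoc, hc]
    split_ifs with ht
    · subst ht
      rw [← add_mul]
      refine mul_le_mul_of_nonneg_right ?_ (hD 0)
      linarith
    · rw [add_zero]
      refine mul_le_mul_of_nonneg_right ?_ (hD t)
      have e : ηy * lam / 2 = 2 * α := by
        rw [hα]
        ring
      rw [e]
      nlinarith
  linarith

/-- Summed descent in expectation. -/
theorem sum_integral_descent [IsProbabilityMeasure μ] [IsProbabilityMeasure ν]
    (A : IsAdmissibleRun μ ν Y f F Ox Oy Lf LF lam σ ΔF x0 y0 v0 ℱ ξ h G0 cl cu γ ηx ηy x y u v)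
    (N : ℕ) :
    ηx * cl / 2 * ∑ t ∈ Finset.range N, ∫ ω, ‖gradient F (x t ω)‖ ^ 2 ∂μ
      + ηx * cl / 4 * ∑ t ∈ Finset.range N, ∫ ω, ‖v (t + 1) ω‖ ^ 2 ∂μ
      ≤ ΔF + ηx * cu / 2 * ∑ t ∈ Finset.range N, ∫ ω, primalErrStar F x v t ω ∂μ := by
  have hcu := A.cu_pos
  have hLF := A.LF_pos
  have hG := fun t => (A.memLp_gradient (A.memLp_iterates t).1).integrable_norm_sq
  have hV := fun t => (A.memLp_iterates (t + 1)).2.2.integrable_norm_sq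
  have hcap : ηx * (cu ^ 2 * LF) ≤ cl / 2 := by
    have := A.ηx_cap
    rw [le_div_iff₀ (by positivity)] at this
    linarith
  have hpt : ∀ᵐ ω ∂μ, (ηx * cl / 2 * ∑ t ∈ Finset.range N, ‖gradient F (x t ω)‖ ^ 2)
      + ηx * cl / 4 * ∑ t ∈ Finset.range N, ‖v (t + 1) ω‖ ^ 2
      ≤ ΔF + ηx * cu / 2 * ∑ t ∈ Finset.range N, primalErrStar F x v t ω := by
    filter_upwards [A.scaling] with ω hω
    have key : ∀ N : ℕ, F (x N ω) + (ηx * cl / 2 * ∑ t ∈ Finset.range N, ‖gradient F (x t ω)‖ ^ 2)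
        + ηx * cl / 4 * ∑ t ∈ Finset.range N, ‖v (t + 1) ω‖ ^ 2
        ≤ F x0 + ηx * cu / 2 * ∑ t ∈ Finset.range N, primalErrStar F x v t ω := by
      intro N
      induction N with
      | zero => simp [A.run.x_zero]
      | succ N ih =>
        simp only [Finset.sum_range_succ]
        have h1 := descent_of_scaled_step A.problem.diff_F A.problem.lip_F A.LF_pos.le
          A.ηx_pos.le A.cl_pos.le hcap (hω N) (x := x N ω) (x' := x (N + 1) ω)
          (v := v (N + 1) ω) (fun i => by
            rw [A.run.x_succ]
            ring)
        simp only [primalErrStar] at ih ⊢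
        linarith
    have h1 := key N
    have h2 := A.problem.init (x N ω)
    linarith
  have hiG := integrable_finsetSum (Finset.range N) fun t _ => hG t
  have hiV := integrable_finsetSum (Finset.range N) fun t _ => hV t
  have hiP := integrable_finsetSum (Finset.range N) fun t _ => A.integrable_primalErrStar t
  have h1 := integral_mono_ae ((hiG.const_mul (ηx * cl / 2)).add (hiV.const_mul (ηx * cl / 4)))
    ((integrable_const ΔF).add (hiP.const_mul (ηx * cu / 2))) hpt
  simp only [Pi.add_apply] at h1
  rw [integral_add (hiG.const_mul _) (hiV.const_mul _),
    integral_add (integrable_const _) (hiP.const_mul _), integral_const_mul, integral_const_mul,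
    integral_const_mul, integral_finsetSum _ fun t _ => hG t,
    integral_finsetSum _ fun t _ => hV t,
    integral_finsetSum _ fun t _ => A.integrable_primalErrStar t] at h1
  simpa using h1

end IsAdmissibleRun

end Run

/-! ### Combination of the recursions -/

/-- The arithmetic of the convergence proof: `SG`, `SV`, `SP`, `SD` stand for the summed
expectations of `‖∇F(x_t)‖²`, `‖v_{t+1}‖²`, the primal and the dual error over `N` iterations. The
step size conditions make the total coefficient of `SV` fed back through `SP` and `SD` small enough
to be absorbed by the `SV` term of the descent inequality. -/
theorem sums_le_of_recursions {cl cu Lf LF lam σ ΔF ε γ ηx ηy D R N SG SV SP SD : ℝ} {T : ℕ}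
    (hcl : 0 < cl) (hcu : cl ≤ cu) (hlam : 0 < lam) (hle : lam ≤ Lf) (hLF : 0 < LF) (hσ : 0 < σ)
    (hε : 0 < ε) (S : StepSizes 1 cl cu Lf LF lam σ ε γ ηx ηy)
    (hT : LongEnough 1 cl cu Lf lam ε γ ηx ηy ΔF D R T) (hN : N = T + 1)
    (hSV : 0 ≤ SV) (hSG : 0 ≤ SG)
    (h1 : ηx * cl / 2 * SG + ηx * cl / 4 * SV ≤ ΔF + ηx * cu / 2 * SP)
    (h2 : γ / 2 * SP ≤ D + (2 / γ * (LF ^ 2 * (ηx * cu) ^ 2) * SV + γ * Lf ^ 2 * SD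
      + γ ^ 2 * σ ^ 2 * N))
    (h3 : ηy * lam / 4 * SD ≤ 6 * R + (2 * (ηy ^ 2 * σ ^ 2) * N
      + 6 / (ηy * lam) * ((Lf / lam) ^ 2 * (ηx * cu) ^ 2) * SV)) :
    SG ≤ N * ε ^ 2 ∧ 2 * SP + 3 * (Lf ^ 2 * SD) ≤ N * (5 * ε ^ 2) ∧
      SP + Lf ^ 2 * SD ≤ N * (5 * ε ^ 2) := by
  have hcu0 : 0 < cu := hcl.trans_le hcu
  have hLf : 0 < Lf := hlam.trans_le hle
  have hγ := S.γ_pos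
  have hηx := S.ηx_pos
  have hηy := S.ηy_pos
  have hT0 : (0 : ℝ) ≤ T := T.cast_nonneg
  have hN0 : 0 < N := by linarith
  set E := N * ε ^ 2 with hE
  have hE0 : 0 < E := by positivity
  set q := cl / cu with hq
  have hq0 : 0 < q := div_pos hcl hcu0
  have hq1 : q ≤ 1 := (div_le_one hcu0).2 hcu
  have hclq : cl = q * cu := by
    rw [hq]
    field_simp
  rw [LongEnough, one_mul, max_le_iff, max_le_iff] at hT
  obtain ⟨t1, t2, t3⟩ := hT
  -- the three bounds on the length, in the form in which they enter the sums
  have b1 : 10 * ΔF ≤ ηx * cl * E := by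
    rw [div_le_iff₀ (by positivity)] at t1
    have : (T : ℝ) * (ηx * cl * ε ^ 2) ≤ N * (ηx * cl * ε ^ 2) := by
      gcongr
      linarith
    rw [hE]
    linarith
  have b2 : 2 / γ * D ≤ 2 / 10 * (q * E) := by
    rw [div_le_iff₀ (by positivity)] at t2
    have h : (T : ℝ) * (γ * cl * ε ^ 2) ≤ N * (γ * cl * ε ^ 2) := by
      gcongr
      linarith
    have h' : cu * (10 * D) ≤ cu * (γ * (q * E)) := by
      rw [hE]
      calc cu * (10 * D) = 10 * cu * D := by ring
        _ ≤ N * (γ * cl * ε ^ 2) := t2.trans h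
        _ = _ := by
          rw [hclq]
          ring
    have h'' := le_of_mul_le_mul_left h' hcu0
    rw [div_mul_eq_mul_div, div_le_iff₀ hγ]
    linarith
  have b3 : Lf ^ 2 * (24 / (ηy * lam) * R) ≤ 24 / 200 * (q * E) := by
    rw [div_le_iff₀ (by positivity)] at t3
    have h : (T : ℝ) * (cl * ηy * lam * ε ^ 2) ≤ N * (cl * ηy * lam * ε ^ 2) := by
      gcongr
      linarith
    have h' : cu * (200 * (Lf ^ 2 * R)) ≤ cu * (ηy * lam * (q * E)) := by
      rw [hE]
      calc cu * (200 * (Lf ^ 2 * R)) = 200 * cu * Lf ^ 2 * R := by ring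
        _ ≤ N * (cl * ηy * lam * ε ^ 2) := t3.trans h
        _ = _ := by
          rw [hclq]
          ring
    have h'' := le_of_mul_le_mul_left h' hcu0
    have e : Lf ^ 2 * (24 / (ηy * lam) * R) = 24 * (Lf ^ 2 * R) / (ηy * lam) := by ring
    rw [e, div_le_iff₀ (by positivity)]
    linarith
  -- the two noise floors
  have b4 : 2 * γ * σ ^ 2 * N ≤ 1 / 20 * (q * E) := by
    have h := S.γ_le
    rw [one_mul, le_div_iff₀ (by positivity)] at h
    have h' : cu * (40 * (γ * σ ^ 2)) ≤ cu * (q * ε ^ 2) := by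
      rw [hclq] at h
      linarith
    have h'' := mul_le_mul_of_nonneg_right (le_of_mul_le_mul_left h' hcu0) hN0.le
    rw [hE]
    linarith
  have b5 : Lf ^ 2 * (8 * ηy * σ ^ 2 * N / lam) ≤ 1 / 50 * (q * E) := by
    have h := S.ηy_le
    rw [one_mul, le_div_iff₀ (by positivity)] at h
    have h' : cu * (400 * (Lf ^ 2 * (ηy * σ ^ 2))) ≤ cu * (q * lam * ε ^ 2) := by
      rw [hclq] at h
      linarith
    have h'' := mul_le_mul_of_nonneg_right (le_of_mul_le_mul_left h' hcu0) hN0.le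
    rw [mul_div_assoc', div_le_iff₀ hlam, hE]
    linarith
  -- the two feedback coefficients
  have hηx2 : ∀ m, ηx ≤ √(cl / cu ^ 3) * m → 0 ≤ m → ηx ^ 2 * cu ^ 2 ≤ q * m ^ 2 := by
    intro m hm hm0
    have h : ηx ^ 2 ≤ (√(cl / cu ^ 3) * m) ^ 2 := by gcongr
    rw [mul_pow, Real.sq_sqrt (by positivity)] at h
    calc ηx ^ 2 * cu ^ 2 ≤ cl / cu ^ 3 * m ^ 2 * cu ^ 2 := by gcongr
      _ = _ := by
        rw [hq]
        field_simp
  have hηx_le := S.ηx_le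
  rw [one_mul] at hηx_le
  have c1 : 4 / γ ^ 2 * (LF ^ 2 * (ηx * cu) ^ 2) ≤ q / 16 := by
    have h := hηx2 (γ / (8 * LF))
      (hηx_le.trans (mul_le_mul_of_nonneg_left (min_le_right _ _) (Real.sqrt_nonneg _)))
      (by positivity)
    calc _ = 4 / γ ^ 2 * LF ^ 2 * (ηx ^ 2 * cu ^ 2) := by ring
      _ ≤ 4 / γ ^ 2 * LF ^ 2 * (q * (γ / (8 * LF)) ^ 2) := by gcongr
      _ = _ := by
        field_simp
        norm_num
  have c2 : Lf ^ 2 * (24 / (ηy * lam) ^ 2 * ((Lf / lam) ^ 2 * (ηx * cu) ^ 2)) ≤ q / 96 := by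
    have h := hηx2 (ηy * lam / (48 * Lf * (Lf / lam)))
      (hηx_le.trans (mul_le_mul_of_nonneg_left (min_le_left _ _) (Real.sqrt_nonneg _)))
      (by positivity)
    calc _ = Lf ^ 2 * (24 / (ηy * lam) ^ 2 * (Lf / lam) ^ 2) * (ηx ^ 2 * cu ^ 2) := by ring
      _ ≤ Lf ^ 2 * (24 / (ηy * lam) ^ 2 * (Lf / lam) ^ 2)
          * (q * (ηy * lam / (48 * Lf * (Lf / lam))) ^ 2) := by gcongr
      _ = _ := by
        field_simp
        norm_num
  have hSD : Lf ^ 2 * SD ≤ 7 / 50 * (q * E) + q / 96 * SV := by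
    have h : SD ≤ 24 / (ηy * lam) * R + 8 * ηy * σ ^ 2 * N / lam
        + 24 / (ηy * lam) ^ 2 * ((Lf / lam) ^ 2 * (ηx * cu) ^ 2) * SV := by
      have h' := mul_le_mul_of_nonneg_left h3 (by positivity : 0 ≤ 4 / (ηy * lam))
      have e1 : 4 / (ηy * lam) * (ηy * lam / 4 * SD) = SD := by field_simp
      have e2 : 4 / (ηy * lam) * (6 * R + (2 * (ηy ^ 2 * σ ^ 2) * N
          + 6 / (ηy * lam) * ((Lf / lam) ^ 2 * (ηx * cu) ^ 2) * SV))
          = 24 / (ηy * lam) * R + 8 * ηy * σ ^ 2 * N / lam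
            + 24 / (ηy * lam) ^ 2 * ((Lf / lam) ^ 2 * (ηx * cu) ^ 2) * SV := by
        field_simp
        ring
      rwa [e1, e2] at h'
    have h4 := mul_le_mul_of_nonneg_left h (sq_nonneg Lf)
    have h5 := mul_le_mul_of_nonneg_right c2 hSV
    linarith
  have hSP : SP ≤ 53 / 100 * (q * E) + q / 12 * SV := by
    have h : SP ≤ 2 / γ * D + 4 / γ ^ 2 * (LF ^ 2 * (ηx * cu) ^ 2) * SV + 2 * (Lf ^ 2 * SD)
        + 2 * γ * σ ^ 2 * N := by
      have h' := mul_le_mul_of_nonneg_left h2 (by positivity : 0 ≤ 2 / γ)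
      have e1 : 2 / γ * (γ / 2 * SP) = SP := by field_simp
      have e2 : 2 / γ * (D + (2 / γ * (LF ^ 2 * (ηx * cu) ^ 2) * SV + γ * Lf ^ 2 * SD
          + γ ^ 2 * σ ^ 2 * N)) = 2 / γ * D + 4 / γ ^ 2 * (LF ^ 2 * (ηx * cu) ^ 2) * SV
            + 2 * (Lf ^ 2 * SD) + 2 * γ * σ ^ 2 * N := by
        field_simp
        ring
      rwa [e1, e2] at h'
    have h5 := mul_le_mul_of_nonneg_right c1 hSV
    linarith
  have hmain : SG + 5 / 12 * SV ≤ 73 / 100 * E := by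
    have h4 : ηx * cu / 2 * SP ≤ ηx * cu / 2 * (53 / 100 * (q * E) + q / 12 * SV) := by gcongr
    have e : ηx * cu / 2 * (53 / 100 * (q * E) + q / 12 * SV)
        = ηx * cl / 2 * (53 / 100 * E + SV / 12) := by
      rw [hclq]
      ring
    have h5 : ηx * cl / 2 * (SG + 5 / 12 * SV) ≤ ηx * cl / 2 * (73 / 100 * E) := by linarith
    exact le_of_mul_le_mul_left h5 (by positivity)
  -- the descent inequality also bounds `SV`, and with it the feedback in `SP` and `SD`
  refine ⟨by linarith, ?_⟩
  have hSV2 : q * SV ≤ q * (876 / 500 * E) := by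
    gcongr
    linarith
  have hqE : q * E ≤ E := mul_le_of_le_one_left hE0.le hq1
  have hN5 : N * (5 * ε ^ 2) = 5 * E := by
    rw [hE]
    ring
  constructor <;> linarith

theorem ExpectLE.timeAvg {Ω : Type*} [MeasurableSpace Ω] {μ : Measure Ω} {Z : ℕ → Ω → ℝ}
    (hZ : ∀ t, Integrable (Z t) μ) {T : ℕ} {b : ℝ}
    (hb : ∑ t ∈ Finset.range (T + 1), ∫ ω, Z t ω ∂μ ≤ ((T : ℝ) + 1) * b) :
    ExpectLE μ (_root_.timeAvg T Z) b := by
  have hT : (0 : ℝ) < T + 1 := by positivity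
  refine ⟨(integrable_finsetSum _ fun t _ => hZ t).const_mul _, ?_⟩
  have e : ∫ ω, _root_.timeAvg T Z ω ∂μ
      = 1 / ((T : ℝ) + 1) * ∑ t ∈ Finset.range (T + 1), ∫ ω, Z t ω ∂μ := by
    rw [← integral_finsetSum _ fun t _ => hZ t, ← integral_const_mul]
    rfl
  rw [e, div_mul_eq_mul_div, one_mul, div_le_iff₀ hT]
  linarith

theorem IsAdmissibleRun.guarantee {d d' : ℕ} {Ω Ξ : Type*} [mΩ : MeasurableSpace Ω]
    [mΞ : MeasurableSpace Ξ] {μ : Measure Ω} [IsProbabilityMeasure μ] {ν : Measure Ξ}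
    [IsProbabilityMeasure ν] {Y : Set (Euc d')} {f : Euc d → Euc d' → ℝ} {F : Euc d → ℝ}
    {Ox : Euc d → Euc d' → Ξ → Euc d} {Oy : Euc d → Euc d' → Ξ → Euc d'}
    {Lf LF lam σ ΔF ε : ℝ} {x0 : Euc d} {y0 : Ω → Euc d'} {v0 : Ω → Euc d}
    {ℱ : Filtration ℕ mΩ} {ξ : ℕ → Ω → Ξ}
    {h : (t : ℕ) → Euc d → (Fin (t + 1) → Euc d) → Euc d} {G0 cl cu γ ηx ηy : ℝ}
    {x : ℕ → Ω → Euc d} {y : ℕ → Ω → Euc d'} {u v : ℕ → Ω → Euc d}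
    (A : IsAdmissibleRun μ ν Y f F Ox Oy Lf LF lam σ ΔF x0 y0 v0 ℱ ξ h G0 cl cu γ ηx ηy x y u v)
    (hσ : 0 < σ) (hε : 0 < ε) (S : StepSizes 1 cl cu Lf LF lam σ ε γ ηx ηy) {D R : ℝ} {T : ℕ}
    (hT : LongEnough 1 cl cu Lf lam ε γ ηx ηy ΔF D R T)
    (hD : (∫ ω, primalErrStar F x v 0 ω ∂μ) ≤ D) (hR : (∫ ω, dualErr Y f x y 0 ω ∂μ) ≤ R) :
    Guarantee μ Y f F Lf ε T x y v := by
  have hγ := A.γ_pos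
  have hηy := A.ηy_pos
  have hlam := A.lam_pos
  have hLf := A.Lf_pos
  have hP0 : ∀ t, 0 ≤ ∫ ω, primalErrStar F x v t ω ∂μ := fun t =>
    integral_nonneg fun ω => sq_nonneg _
  have hD0 : ∀ t, 0 ≤ ∫ ω, dualErr Y f x y t ω ∂μ := fun t => integral_nonneg fun ω => sq_nonneg _
  have hV0 : ∀ t, 0 ≤ ∫ ω, ‖v (t + 1) ω‖ ^ 2 ∂μ := fun t => integral_nonneg fun ω => sq_nonneg _
  have hρ : ηy * lam / 4 ≤ 1 := by linarith [A.ηy_mul_lam_le]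
  have r1 := A.sum_integral_descent (T + 1)
  have r2 := mul_sum_range_succ_le (by linarith [A.γ_cap]) hP0 A.integral_primalErrStar_succ_le T
  have r3 := mul_sum_range_succ_le hρ hD0 A.integral_dualErr_succ_le T
  have hVle : ∑ t ∈ Finset.range T, ∫ ω, ‖v (t + 1) ω‖ ^ 2 ∂μ
      ≤ ∑ t ∈ Finset.range (T + 1), ∫ ω, ‖v (t + 1) ω‖ ^ 2 ∂μ := by
    rw [Finset.sum_range_succ]
    linarith [hV0 T]
  have hDle : ∑ t ∈ Finset.range T, ∫ ω, dualErr Y f x y (t + 1) ω ∂μ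
      ≤ ∑ t ∈ Finset.range (T + 1), ∫ ω, dualErr Y f x y t ω ∂μ := by
    rw [Finset.sum_range_succ']
    linarith [hD0 0]
  have hite : ∑ t ∈ Finset.range T, (if t = 0 then 5 * ∫ ω, dualErr Y f x y 0 ω ∂μ else 0)
      ≤ 5 * ∫ ω, dualErr Y f x y 0 ω ∂μ := by
    rw [Finset.sum_ite_eq']
    split_ifs
    · exact le_rfl
    · linarith [hD0 0]
  simp only [Finset.sum_add_distrib, ← Finset.mul_sum, Finset.sum_const, Finset.card_range,
    nsmul_eq_mul] at r2 r3
  have k1 := mul_le_mul_of_nonneg_left hVle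
    (by positivity : 0 ≤ 2 / γ * (LF ^ 2 * (ηx * cu) ^ 2))
  have k2 := mul_le_mul_of_nonneg_left hDle (by positivity : 0 ≤ γ * Lf ^ 2)
  have k3 := mul_le_mul_of_nonneg_left hVle
    (by positivity : 0 ≤ 6 / (ηy * lam) * ((Lf / lam) ^ 2 * (ηx * cu) ^ 2))
  have k4 : 0 ≤ γ ^ 2 * σ ^ 2 := by positivity
  have k5 : 0 ≤ 2 * (ηy ^ 2 * σ ^ 2) := by positivity
  have hfin := sums_le_of_recursions A.cl_pos A.cl_le hlam A.lam_le A.LF_pos hσ hε S hT rfl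
    (SD := ∑ t ∈ Finset.range (T + 1), ∫ ω, dualErr Y f x y t ω ∂μ)
    (Finset.sum_nonneg fun t _ => hV0 t) (Finset.sum_nonneg fun t _ => integral_nonneg
      fun ω => sq_nonneg _) r1 (by linarith) (by linarith)
  have hiG := fun t => (A.memLp_gradient (A.memLp_iterates t).1).integrable_norm_sq
  have hiD := fun t => (A.integrable_dualErr t).const_mul (Lf ^ 2)
  refine ⟨ExpectLE.timeAvg hiG hfin.1,
    ExpectLE.timeAvg (fun t => (A.integrable_primalErr t).add (hiD t)) ?_,
    ExpectLE.timeAvg (fun t => (A.integrable_primalErrStar t).add (hiD t)) ?_⟩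
  · refine le_trans ?_ hfin.2.1
    rw [Finset.mul_sum, Finset.mul_sum, Finset.mul_sum, ← Finset.sum_add_distrib]
    refine Finset.sum_le_sum fun t _ => ?_
    have hi := ((A.integrable_primalErrStar t).const_mul 2).add ((hiD t).const_mul 3)
    have h1 := integral_mono ((A.integrable_primalErr t).add (hiD t)) hi fun ω => by
      have e1 := norm_add_sq_le_two (v (t + 1) ω - gradient F (x t ω))
        (gradient F (x t ω) - gradX f (x t ω) (y t ω))
      rw [sub_add_sub_cancel, norm_sub_rev (gradient F (x t ω))] at e1
      have e2 := A.problem.norm_gradX_sub_gradient_sq_le hlam hLf.le (x t ω) (y t ω)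
      simp only [Pi.add_apply, primalErr, primalErrStar, dualErr]
      linarith
    simp only [Pi.add_apply] at h1
    rw [integral_add ((A.integrable_primalErrStar t).const_mul 2) ((hiD t).const_mul 3),
      integral_const_mul, integral_const_mul, integral_const_mul] at h1
    exact h1
  · refine le_trans (le_of_eq ?_) hfin.2.2
    rw [Finset.mul_sum, ← Finset.sum_add_distrib]
    refine Finset.sum_congr rfl fun t _ => ?_
    rw [integral_add' (A.integrable_primalErrStar t) (hiD t), integral_const_mul]

/-! ### Choice of the parameters -/

/-- Step sizes `γ ∼ ε²`, `ηy ∼ ε² / κ`, `ηx ∼ ε² / κ³`, with factors that do not depend on `κ` and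
`ε`, satisfy all conditions, and then `κ³ / ε⁴` iterations are enough. -/
theorem exists_parameters {cl cu Lf σ ΔF D R B : ℝ} (hcl : 0 < cl) (hcu : cl ≤ cu) (hLf : 0 < Lf)
    (hσ : 0 < σ) (hΔ : 0 ≤ ΔF) (hD : 0 ≤ D) (hR : 0 ≤ R) (hB : 0 < B) :
    ∃ K : ℝ, 0 < K ∧ ∀ lam LF ε : ℝ, 0 < lam → lam ≤ Lf → 0 < LF → LF ≤ B * (Lf / lam) →
      0 < ε → ε ≤ 1 → ∃ (γ ηx ηy : ℝ) (T : ℕ), StepSizes 1 cl cu Lf LF lam σ ε γ ηx ηy ∧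
        LongEnough 1 cl cu Lf lam ε γ ηx ηy ΔF D R T ∧
        (T : ℝ) + 1 ≤ K * ((Lf / lam) ^ 3 / ε ^ 4) := by
  have hcu0 : 0 < cu := hcl.trans_le hcu
  obtain ⟨g, hg0, hg1, hg2⟩ : ∃ g : ℝ, 0 < g ∧ g ≤ cl / (40 * cu * σ ^ 2) ∧ g ≤ 1 / 4 :=
    ⟨min (cl / (40 * cu * σ ^ 2)) (1 / 4), by positivity, min_le_left _ _, min_le_right _ _⟩
  obtain ⟨b, hb0, hb1, hb2⟩ : ∃ b : ℝ, 0 < b ∧ b ≤ cl / (400 * cu * Lf ^ 2 * σ ^ 2) ∧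
      b ≤ 1 / (2 * Lf ^ 2) :=
    ⟨min (cl / (400 * cu * Lf ^ 2 * σ ^ 2)) (1 / (2 * Lf ^ 2)), by positivity,
      min_le_left _ _, min_le_right _ _⟩
  have hS : 0 < √(cl / cu ^ 3) := Real.sqrt_pos.2 (by positivity)
  set S := √(cl / cu ^ 3) with hSdef
  obtain ⟨e, he0, he1, he2, he3⟩ : ∃ e : ℝ, 0 < e ∧ e ≤ S * (b * Lf / 48) ∧ e ≤ S * (g / (8 * B)) ∧
      e ≤ cl / (2 * cu ^ 2 * B) :=
    ⟨min (S * (b * Lf / 48)) (min (S * (g / (8 * B))) (cl / (2 * cu ^ 2 * B))), by positivity,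
      min_le_left _ _, (min_le_right _ _).trans (min_le_left _ _),
      (min_le_right _ _).trans (min_le_right _ _)⟩
  set k1 := 10 * ΔF / (e * cl) with hk1
  set k2 := 10 * cu * D / (g * cl) with hk2
  set k3 := 200 * cu * R / (cl * b) with hk3
  have hk1' : 0 ≤ k1 := by positivity
  have hk2' : 0 ≤ k2 := by positivity
  have hk3' : 0 ≤ k3 := by positivity
  refine ⟨k1 + k2 + k3 + 2, by positivity, fun lam LF ε hlam hle hLF hLFB hε hε1 => ?_⟩
  obtain ⟨κ, hκ⟩ : ∃ κ, κ = Lf / lam := ⟨_, rfl⟩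
  have hκ1 : 1 ≤ κ := hκ ▸ (one_le_div hlam).2 hle
  have hκ0 : 0 < κ := zero_lt_one.trans_le hκ1
  have hlamκ : lam = Lf / κ := by
    rw [hκ]
    field_simp
  have hε2 : ε ^ 2 ≤ 1 := pow_le_one₀ hε.le hε1
  have hκ13 : κ ≤ κ ^ 3 := le_self_pow₀ hκ1 (by norm_num)
  have hκ23 : κ ^ 2 ≤ κ ^ 3 := pow_le_pow_right₀ hκ1 (by norm_num)
  rw [← hκ] at hLFB ⊢
  have hεκ : ε ^ 2 / κ ^ 3 ≤ ε ^ 2 / κ := by gcongr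
  have hεκ1 : ε ^ 2 / κ ^ 3 ≤ 1 / κ := by gcongr
  obtain ⟨γ, hγ⟩ : ∃ γ, γ = g * ε ^ 2 := ⟨_, rfl⟩
  obtain ⟨ηy, hηy⟩ : ∃ ηy, ηy = b * lam * ε ^ 2 := ⟨_, rfl⟩
  obtain ⟨ηx, hηx⟩ : ∃ ηx, ηx = e * (ε ^ 2 / κ ^ 3) := ⟨_, rfl⟩
  have hγ0 : 0 < γ := hγ ▸ by positivity
  have hηy0 : 0 < ηy := hηy ▸ by positivity
  have hηx0 : 0 < ηx := hηx ▸ by positivity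
  have hSS : StepSizes 1 cl cu Lf LF lam σ ε γ ηx ηy := by
    refine ⟨hγ0, hηx0, hηy0, ?_, ?_, ?_, ?_, ?_, ?_⟩
    · calc γ ≤ cl / (40 * cu * σ ^ 2) * ε ^ 2 := by
            rw [hγ]
            gcongr
        _ = _ := by ring
    · rw [one_mul, ← hSdef, mul_min_of_nonneg _ _ hS.le, le_min_iff]
      constructor
      · calc ηx ≤ S * (b * Lf / 48) * (ε ^ 2 / κ ^ 3) := by
              rw [hηx]
              gcongr
          _ = _ := by
            rw [← hκ, hηy, hlamκ]
            field_simp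
      · calc ηx ≤ S * (g / (8 * B)) * (ε ^ 2 / κ) := by
              rw [hηx]
              gcongr
          _ = S * (γ / (8 * (B * κ))) := by
            rw [hγ]
            field_simp
          _ ≤ _ := by gcongr
    · calc ηy ≤ cl / (400 * cu * Lf ^ 2 * σ ^ 2) * lam * ε ^ 2 := by
            rw [hηy]
            gcongr
        _ = _ := by ring
    · rw [hγ]
      nlinarith
    · calc ηx ≤ cl / (2 * cu ^ 2 * B) * (1 / κ) := by
            rw [hηx]
            gcongr
        _ = cl / (2 * cu ^ 2 * (B * κ)) := by
          field_simp
        _ ≤ _ := by gcongr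
    · calc ηy ≤ 1 / (2 * Lf ^ 2) * lam * 1 := by
            rw [hηy]
            gcongr
        _ = _ := by ring
  set Q := κ ^ 3 / ε ^ 4 with hQ
  have hQ0 : 0 < Q := by positivity
  have hQ1 : 1 ≤ Q := by
    rw [hQ, one_le_div (by positivity)]
    exact (pow_le_one₀ hε.le hε1).trans (one_le_pow₀ hκ1)
  have hceil := Nat.le_ceil ((k1 + k2 + k3) * Q)
  have hceil2 := (Nat.ceil_lt_add_one (by positivity : 0 ≤ (k1 + k2 + k3) * Q)).le
  refine ⟨γ, ηx, ηy, ⌈(k1 + k2 + k3) * Q⌉₊, hSS, ?_, by linarith⟩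
  have m1 : 10 * ΔF / (ηx * cl * ε ^ 2) = k1 * Q := by
    rw [hηx, hk1, hQ]
    field_simp
  have m2 : 10 * cu * D / (γ * cl * ε ^ 2) ≤ k2 * Q := by
    have h1 : 10 * cu * D / (γ * cl * ε ^ 2) = k2 * (1 / ε ^ 4) := by
      rw [hγ, hk2]
      field_simp
    rw [h1, hQ]
    gcongr
    exact one_le_pow₀ hκ1
  have m3 : 200 * cu * Lf ^ 2 * R / (cl * ηy * lam * ε ^ 2) ≤ k3 * Q := by
    have h1 : 200 * cu * Lf ^ 2 * R / (cl * ηy * lam * ε ^ 2) = k3 * (κ ^ 2 / ε ^ 4) := by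
      rw [hηy, hk3, hlamκ]
      field_simp
    rw [h1, hQ]
    gcongr
  have p1 := mul_nonneg hk1' hQ0.le
  have p2 := mul_nonneg hk2' hQ0.le
  have p3 := mul_nonneg hk3' hQ0.le
  rw [LongEnough, one_mul]
  refine max_le ?_ (max_le ?_ ?_) <;> linarith

theorem theorem4 :
    ∃ a C : ℝ, 0 < a ∧ 0 < C ∧
      -- convergence, with universal constants `a`, `C`
      (∀ (cl cu Lf LF lam σ ΔF ε γ ηx ηy : ℝ) (T : ℕ),
        0 < cl → cl ≤ cu → 0 < lam → lam ≤ Lf → 0 < LF → 0 < σ → 0 < ε →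
        StepSizes a cl cu Lf LF lam σ ε γ ηx ηy →
        ∀ (d d' : ℕ) (Ω : Type*) (Ξ : Type*) [mΩ : MeasurableSpace Ω] [MeasurableSpace Ξ]
          (μ : Measure Ω) [IsProbabilityMeasure μ] (ν : Measure Ξ) [IsProbabilityMeasure ν]
          (Y : Set (Euc d')) (f : Euc d → Euc d' → ℝ) (F : Euc d → ℝ)
          (Ox : Euc d → Euc d' → Ξ → Euc d) (Oy : Euc d → Euc d' → Ξ → Euc d')
          (x0 : Euc d) (y0 : Ω → Euc d') (v0 : Ω → Euc d)
          (ℱ : Filtration ℕ mΩ) (ξ : ℕ → Ω → Ξ)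
          (h : (t : ℕ) → Euc d → (Fin (t + 1) → Euc d) → Euc d) (G0 : ℝ)
          (x : ℕ → Ω → Euc d) (y : ℕ → Ω → Euc d') (u v : ℕ → Ω → Euc d),
          MinMaxAssumption ν Y f F Ox Oy Lf LF lam σ ΔF x0 →
          IsSampling μ ν ℱ ξ y0 v0 →
          (∀ t, Measurable (fun p : Euc d × (Fin (t + 1) → Euc d) => h t p.1 p.2)) → 0 ≤ G0 →
          IsPDAdaRun Y Ox Oy h G0 γ ηx ηy ξ x0 y0 v0 x y u v →
          ScalingBounded μ G0 cl cu u →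
          LongEnough C cl cu Lf lam ε γ ηx ηy ΔF
            (∫ ω, primalErrStar F x v 0 ω ∂μ) (∫ ω, dualErr Y f x y 0 ω ∂μ) T →
          Guarantee μ Y f F Lf ε T x y v) ∧
      -- sample complexity: `T + 1` oracle calls are `O(κ³ / ε⁴)`, with a constant `K` that
      -- does not depend on `κ = Lf / lam`, on `ε` or on the dimensions, where `LF = O(κ)`
      (∀ (cl cu Lf σ ΔF D R B : ℝ),
        0 < cl → cl ≤ cu → 0 < Lf → 0 < σ → 0 ≤ ΔF → 0 ≤ D → 0 ≤ R → 0 < B →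
        ∃ K : ℝ, 0 < K ∧ ∀ (lam LF ε : ℝ),
          0 < lam → lam ≤ Lf → 0 < LF → LF ≤ B * (Lf / lam) → 0 < ε → ε ≤ 1 →
          ∃ (γ ηx ηy : ℝ) (T : ℕ),
            StepSizes a cl cu Lf LF lam σ ε γ ηx ηy ∧
            LongEnough C cl cu Lf lam ε γ ηx ηy ΔF D R T ∧
            (T : ℝ) + 1 ≤ K * ((Lf / lam) ^ 3 / ε ^ 4) ∧
            ∀ (d d' : ℕ) (Ω : Type*) (Ξ : Type*) [mΩ : MeasurableSpace Ω] [MeasurableSpace Ξ]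
              (μ : Measure Ω) [IsProbabilityMeasure μ] (ν : Measure Ξ) [IsProbabilityMeasure ν]
              (Y : Set (Euc d')) (f : Euc d → Euc d' → ℝ) (F : Euc d → ℝ)
              (Ox : Euc d → Euc d' → Ξ → Euc d) (Oy : Euc d → Euc d' → Ξ → Euc d')
              (x0 : Euc d) (y0 : Ω → Euc d') (v0 : Ω → Euc d)
              (ℱ : Filtration ℕ mΩ) (ξ : ℕ → Ω → Ξ)
              (h : (t : ℕ) → Euc d → (Fin (t + 1) → Euc d) → Euc d) (G0 : ℝ)
              (x : ℕ → Ω → Euc d) (y : ℕ → Ω → Euc d') (u v : ℕ → Ω → Euc d),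
              MinMaxAssumption ν Y f F Ox Oy Lf LF lam σ ΔF x0 →
              IsSampling μ ν ℱ ξ y0 v0 →
              (∀ t, Measurable
                (fun p : Euc d × (Fin (t + 1) → Euc d) => h t p.1 p.2)) → 0 ≤ G0 →
              IsPDAdaRun Y Ox Oy h G0 γ ηx ηy ξ x0 y0 v0 x y u v →
              ScalingBounded μ G0 cl cu u →
              (∫ ω, primalErrStar F x v 0 ω ∂μ) ≤ D →
              (∫ ω, dualErr Y f x y 0 ω ∂μ) ≤ R →
              Guarantee μ Y f F Lf ε T x y v) := by
  refine ⟨1, 1, one_pos, one_pos, ?_, ?_⟩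
  · intro cl cu Lf LF lam σ ΔF ε γ ηx ηy T hcl hcu hlam hle hLF hσ hε S d d' Ω Ξ _ _ μ _ ν _ Y f F
      Ox Oy x0 y0 v0 ℱ ξ h G0 x y u v hprob hsamp hh _ hrun hscal hT
    have A : IsAdmissibleRun μ ν Y f F Ox Oy Lf LF lam σ ΔF x0 y0 v0 ℱ ξ h G0 cl cu γ ηx ηy
        x y u v :=
      ⟨hprob, hsamp, hh, hrun, hscal, hcl, hcu, hlam, hle, hLF, S.γ_pos, S.ηx_pos, S.ηy_pos,
        S.γ_cap, S.ηx_cap, S.ηy_cap⟩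
    exact A.guarantee hσ hε S hT le_rfl le_rfl
  · intro cl cu Lf σ ΔF D R B hcl hcu hLf hσ hΔ hD hR hB
    obtain ⟨K, hK, hpar⟩ := exists_parameters hcl hcu hLf hσ hΔ hD hR hB
    refine ⟨K, hK, fun lam LF ε hlam hle hLF hLFB hε hε1 => ?_⟩
    obtain ⟨γ, ηx, ηy, T, S, hT, hTK⟩ := hpar lam LF ε hlam hle hLF hLFB hε hε1
    refine ⟨γ, ηx, ηy, T, S, hT, hTK, ?_⟩
    intro d d' Ω Ξ _ _ μ _ ν _ Y f F Ox Oy x0 y0 v0 ℱ ξ h G0 x y u v hprob hsamp hh _ hrun hscal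
      hD0 hR0
    have A : IsAdmissibleRun μ ν Y f F Ox Oy Lf LF lam σ ΔF x0 y0 v0 ℱ ξ h G0 cl cu γ ηx ηy
        x y u v :=
      ⟨hprob, hsamp, hh, hrun, hscal, hcl, hcu, hlam, hle, hLF, S.γ_pos, S.ηx_pos, S.ηy_pos,
        S.γ_cap, S.ηx_cap, S.ηy_cap⟩
    exact A.guarantee hσ hε S hT hD0 hR0
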